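/- Let $k$ be a field and let $X$ be an algebraic $k$-scheme (separated and of finite type over $k$) that is equidimensional, i.e. all its irreducible components have dimension $\dim X$. For $x\in X$ put $\operatorname{codim}(x):=\dim X-\dim\overline{\{x\}}$, let $X^{(p)}$ be the set of points of codimension $p$, and let $F_jX:=\{x\in X\mid \operatorname{codim}(x)\le j\}$ for $j\in\mathbb Z$. Let $X_\nu$ be a (small) site and $\pi:X_\nu\to X_{\mathrm{Zar}}$ a morphism of sites, given by a continuous, finite-limit preserving functor $U\mapsto U_\nu$ from the Zariski open subsets of $X$ to the underlying category of $X_\nu$ (for instance the morphism associated to a Grothendieck topology $\nu$ on schemes over $k$ that contains all Zariski open coverings). Let $K^\bullet\in D(X_\nu,\mathbb Z)$ be an (unbounded) complex of sheaves of abelian groups; derived functors are formed by means of K-injective replacements. For Zariski open $U\subset X$ write $H^i(U_\nu,K^\bullet):=R^i\Gamma(U_\nu,K^\bullet)$, and put $$H^i(F_jX,K^\bullet):=\operatorname{colim}_{U\supset F_jX}H^i(U_\nu,K^\bullet),\qquad H^i_{j,nr}(X_\nu,K^\bullet):=\operatorname{im}\bigl(H^i(F_{j+1}X,K^\bullet)\to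 H^i(F_jX,K^\bullet)\bigr),$$ where $U$ runs through the Zariski open subsets of $X$ that contain $F_jX$. The groups $H^i(F_jX,L^\bullet)$ for $L^\bullet\in D(X_{\mathrm{Zar}},\mathbb Z)$ are defined in the same way. Suppose that there are abelian groups $A^n_x$ ($n\in\mathbb Z$, $x\in X$) such that for every $i\in\mathbb Z$ the Zariski sheaf $R^i\pi_*K^\bullet$ has a resolution $R^i\pi_*K^\bullet\to\mathcal E^{i,\bullet}$ by a complex concentrated in degrees $\ge 0$ whose term in degree $p$ is $$\mathcal E^{i,p}\cong\bigoplus_{x\in X^{(p)}}\iota_{x*}\underline{A}^{i+p}_x ,$$ where $\iota_{x*}\underline{A}^{i+p}_x$ is the constant sheaf with value $A^{i+p}_x$ on $\overline{\{x\}}$, extended by zero to $X$. Then for all integers $i$ and $s$ there is a canonical isomorphism $$\varphi: H^i(X_{\mathrm{Zar}},\tau_{\ge s}R\pi_*K^\bullet)\xrightarrow{\ \cong\ }H^i_{i-s,nr}(X_\nu,K^\bullet).$$ More precisely, there is exactly one isomorphism $\varphi$ of abelian groups such that for all $z$ the image of $\varphi(z)\in H^i(F_{i-s}X,K^\bullet)$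 under the map $$H^i(F_{i-s}X,K^\bullet)=H^i(F_{i-s}X,R\pi_*K^\bullet)\to H^i(F_{i-s}X,\tau_{\ge s}R\pi_*K^\bullet)$$ induced by $R\pi_*K^\bullet\to\tau_{\ge s}R\pi_*K^\bullet$ is the restriction of $z$ to $F_{i-s}X$. -/

import Mathlib

universe w v u

/-! ### Existence of K-injective replacements in Grothendieck abelian categories -/

namespace KInjectiveResolution

open CategoryTheory Limits HomologicalComplex ZeroObject

section Abelian

variable {A : Type u} [Category.{v} A] [Abelian A]

/-- The monomorphisms that are quasi-isomorphisms. -/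
def acyclicMono : MorphismProperty (CochainComplex A ℤ) := fun _ _ f ↦ Mono f ∧ QuasiIso f

lemma shortExact_cokernel {X Y : CochainComplex A ℤ} (f : X ⟶ Y) [Mono f] :
    (ShortComplex.mk f (cokernel.π f) (cokernel.condition f)).ShortExact where
  exact := ShortComplex.exact_cokernel f

lemma quasiIso_of_acyclic_cokernel {X Y : CochainComplex A ℤ} (f : X ⟶ Y) [Mono f]
    (h : (cokernel f).Acyclic) : QuasiIso f where
  quasiIsoAt n := by
    have hS := shortExact_cokernel f
    have h0 (i : ℤ) : IsZero ((cokernel f).homology i) :=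
      (exactAt_iff_isZero_homology _ _).1 (h i)
    rw [quasiIsoAt_iff_isIso_homologyMap]
    have h1 : Mono (homologyMap f n) :=
      (hS.homology_exact₁ (n - 1) n (by simp)).mono_g ((h0 _).eq_of_src _ _)
    have h2 : Epi (homologyMap f n) :=
      (hS.homology_exact₂ n).epi_f ((h0 _).eq_of_tgt _ _)
    exact isIso_of_mono_of_epi _

lemma acyclicMono.acyclic_cokernel {X Y : CochainComplex A ℤ} {f : X ⟶ Y} (h : acyclicMono f) :
    (cokernel f).Acyclic :=
  have := h.1
  (shortExact_cokernel f).acyclic_X₃ h.2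

/-- The acyclic complex with `E` in degrees `n` and `n + 1`. -/
noncomputable abbrev disk (E : A) (n : ℤ) : CochainComplex A ℤ :=
  double (𝟙 E) (show (ComplexShape.up ℤ).Rel n (n + 1) from rfl)

open scoped Classical in
/-- The morphism to a disk induced by a morphism in degree `n + 1`. -/
noncomputable def toDisk {Y : CochainComplex A ℤ} {E : A} {n : ℤ} (φ : Y.X (n + 1) ⟶ E) :
    Y ⟶ disk E n where
  f k :=
    if h₀ : k = n then
      Y.d k (n + 1) ≫ φ ≫ (doubleXIso₀ (𝟙 E)
        (show (ComplexShape.up ℤ).Rel n (n + 1) from rfl)).inv ≫ eqToHom (by rw [h₀])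
    else if h₁ : k = n + 1 then
      eqToHom (by rw [h₁]) ≫ φ ≫ (doubleXIso₁ (𝟙 E)
        (show (ComplexShape.up ℤ).Rel n (n + 1) from rfl) (by lia)).inv ≫ eqToHom (by rw [h₁])
    else 0
  comm' i j hij := by
    obtain rfl : i + 1 = j := hij
    by_cases h : i = n
    · subst h
      simp [double_d _ (show (ComplexShape.up ℤ).Rel i (i + 1) from rfl) (by lia)]
    · rw [double_d_eq_zero₀ _ _ _ _ h, comp_zero]
      by_cases h' : i + 1 = n
      · subst h'
        simp
      · simp [h, h']

lemma toDisk_f₀ {Y : CochainComplex A ℤ} {E : A} {n : ℤ} (φ : Y.X (n + 1) ⟶ E) :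
    (toDisk φ).f n = Y.d n (n + 1) ≫ φ ≫ (doubleXIso₀ (𝟙 E) _).inv := by
  simp [toDisk]

lemma toDisk_f₁ {Y : CochainComplex A ℤ} {E : A} {n : ℤ} (φ : Y.X (n + 1) ⟶ E) :
    (toDisk φ).f (n + 1) = φ ≫ (doubleXIso₁ (𝟙 E) _ (by lia)).inv := by
  simp [toDisk]

/-- The projection from a disk. -/
noncomputable def diskπ (E : A) (n : ℤ) : disk E n ⟶ (single A (.up ℤ) n).obj E :=
  mkHomToSingle (doubleXIso₀ (𝟙 E) _).hom
    (fun i hi ↦ by rw [double_d_eq_zero₁ _ _ _ _ (by lia), zero_comp])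

variable (A) in
/-- The projections from the disks on injective objects. -/
def diskProjections : MorphismProperty (CochainComplex A ℤ) := fun _ _ p ↦
  ∃ (E : A) (_ : Injective E) (n : ℤ), Nonempty (Arrow.mk p ≅ Arrow.mk (diskπ E n))

lemma diskπ_mem (E : A) [Injective E] (n : ℤ) : diskProjections A (diskπ E n) :=
  ⟨E, inferInstance, n, ⟨Iso.refl _⟩⟩

lemma exists_of_hasLiftingProperty {X Y : CochainComplex A ℤ} (f : X ⟶ Y) (E : A) (n : ℤ)
    [HasLiftingProperty f (diskπ E n)] (u : X.X (n + 1) ⟶ E) (φ : Y.X n ⟶ E)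
    (hφ : ∀ i, Y.d i n ≫ φ = 0) (h : f.f n ≫ φ = X.d n (n + 1) ≫ u) :
    ∃ w : Y.X (n + 1) ⟶ E, f.f (n + 1) ≫ w = u ∧ Y.d n (n + 1) ≫ w = φ := by
  have sq : CommSq (toDisk u) f (diskπ E n) (mkHomToSingle φ (fun i _ ↦ hφ i)) := ⟨by
    ext
    simp [diskπ, toDisk_f₀, h]⟩
  obtain ⟨l, hl₁, hl₂⟩ : sq.LiftStruct := (HasLiftingProperty.sq_hasLift sq).exists_lift.some
  have h2 := congr_arg (fun g ↦ g.f n ≫ (singleObjXSelf _ n E).hom) hl₂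
  have h2' := congr_arg (fun g ↦ g.f (n + 1) ≫ (doubleXIso₁ (𝟙 E) _ (by lia)).hom) hl₁
  have h3 := l.comm n (n + 1)
  refine ⟨l.f (n + 1) ≫ (doubleXIso₁ (𝟙 E) _ (by lia)).hom, ?_, ?_⟩
  · simpa [toDisk_f₁] using h2'
  · rw [← Category.assoc, ← h3]
    simpa [diskπ, double_d _ (show (ComplexShape.up ℤ).Rel n (n + 1) from rfl) (by lia)] using h2

lemma acyclicMono_le_llp : acyclicMono ≤ (diskProjections A).llp := by
  intro X Y f hf P Q p ⟨E, _, n, ⟨e⟩⟩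
  suffices HasLiftingProperty f (diskπ E n) from HasLiftingProperty.of_arrow_iso_right f e.symm
  have := hf.1
  have hM := hf.acyclic_cokernel
  have hS := shortExact_cokernel f
  refine ⟨fun {a b} sq ↦ ?_⟩
  let u : X.X (n + 1) ⟶ E := a.f (n + 1) ≫ (doubleXIso₁ (𝟙 E) _ (by lia)).hom
  let φ : Y.X n ⟶ E := b.f n ≫ (singleObjXSelf _ n E).hom
  have hφ : Y.d (n - 1) n ≫ φ = 0 := by
    simp only [φ]
    rw [← Category.assoc, ← b.comm]
    simp
  have hu : X.d n (n + 1) ≫ u = f.f n ≫ φ := by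
    have h1 := congr_arg (fun g ↦ g.f n ≫ (singleObjXSelf _ n E).hom) sq.w
    simp only [u, φ]
    rw [← Category.assoc, ← a.comm]
    simpa [diskπ, double_d _ (show (ComplexShape.up ℤ).Rel n (n + 1) from rfl) (by lia)] using h1
  let w := Injective.factorThru u (f.f (n + 1))
  have hw : f.f (n + 1) ≫ w = u := Injective.comp_factorThru _ _
  have hSn : (ShortComplex.mk (f.f n) ((cokernel.π f).f n)
      (by rw [← comp_f, cokernel.condition, zero_f])).ShortExact :=
    hS.map_of_exact (eval A (.up ℤ) n)
  have := hSn.epi_g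
  obtain ⟨ψ, hψ⟩ : ∃ ψ : (cokernel f).X n ⟶ E,
      (cokernel.π f).f n ≫ ψ = φ - Y.d n (n + 1) ≫ w :=
    ⟨hSn.exact.desc (φ - Y.d n (n + 1) ≫ w) (by simp [hw, hu]), hSn.exact.g_desc _ _⟩
  have hSn' : (ShortComplex.mk (f.f (n - 1)) ((cokernel.π f).f (n - 1))
      (by rw [← comp_f, cokernel.condition, zero_f])).ShortExact :=
    hS.map_of_exact (eval A (.up ℤ) (n - 1))
  have := hSn'.epi_g
  have hψ' : (cokernel f).d (n - 1) n ≫ ψ = 0 := by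
    rw [← cancel_epi ((cokernel.π f).f (n - 1))]
    dsimp at *
    rw [← Category.assoc, (cokernel.π f).comm, Category.assoc, hψ]
    simp [hφ]
  have hex := hM n
  rw [exactAt_iff' _ (n - 1) n (n + 1) (by simp) (by simp)] at hex
  let t : (cokernel f).X (n + 1) ⟶ E := hex.descToInjective ψ hψ'
  have ht : (cokernel f).d n (n + 1) ≫ t = ψ := hex.comp_descToInjective ψ hψ'
  refine ⟨⟨toDisk (w + (cokernel.π f).f (n + 1) ≫ t), ?_, ?_⟩⟩
  · have h0 : f.f (n + 1) ≫ (cokernel.π f).f (n + 1) = 0 := by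
      rw [← comp_f, cokernel.condition, zero_f]
    have h1 : f.f (n + 1) ≫ (w + (cokernel.π f).f (n + 1) ≫ t) = u := by
      rw [Preadditive.comp_add, hw, reassoc_of% h0, zero_comp, add_zero]
    apply to_double_hom_ext
    · rw [comp_f, toDisk_f₀, f.comm_assoc, reassoc_of% h1]
      have := a.comm n (n + 1)
      rw [double_d _ (show (ComplexShape.up ℤ).Rel n (n + 1) from rfl) (by lia)] at this
      simp only [u, Category.assoc, ← reassoc_of% this]
      simp
    · rw [comp_f, toDisk_f₁, reassoc_of% h1]
      simp [u]
  · ext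
    simp only [comp_f, toDisk_f₀, diskπ, mkHomToSingle_f, Category.assoc]
    have : Y.d n (n + 1) ≫ (w + (cokernel.π f).f (n + 1) ≫ t) = φ := by
      rw [Preadditive.comp_add, ← Hom.comm_assoc, ht, hψ]
      simp
    rw [reassoc_of% this]
    simp [φ]

lemma acyclicMono_of_llp [EnoughInjectives A] {X Y : CochainComplex A ℤ} (f : X ⟶ Y) [Mono f]
    (hf : (diskProjections A).llp f) : acyclicMono f := by
  refine ⟨inferInstance, quasiIso_of_acyclic_cokernel f fun n ↦ ?_⟩
  have hS := shortExact_cokernel f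
  have hSn (n : ℤ) : (ShortComplex.mk (f.f n) ((cokernel.π f).f n)
      (by rw [← comp_f, cokernel.condition, zero_f])).ShortExact :=
    hS.map_of_exact (eval A (.up ℤ) n)
  have hepi (n : ℤ) : Epi ((cokernel.π f).f n) := (hSn n).epi_g
  let M := cokernel f
  let E := Injective.under (M.opcycles n)
  let φ : M.X n ⟶ E := M.pOpcycles n ≫ Injective.ι _
  have hφ (i : ℤ) : M.d i n ≫ φ = 0 := by simp [φ]
  have h0 (n : ℤ) : f.f n ≫ (cokernel.π f).f n = 0 := by
    rw [← comp_f, cokernel.condition, zero_f]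
  have := hf _ (diskπ_mem E n)
  obtain ⟨w, hw₁, hw₂⟩ := exists_of_hasLiftingProperty f E n 0 ((cokernel.π f).f n ≫ φ)
    (fun i ↦ by rw [← Hom.comm_assoc, hφ, comp_zero]) (by rw [reassoc_of% (h0 n)]; simp)
  obtain ⟨t, ht⟩ : ∃ t : M.X (n + 1) ⟶ E, (cokernel.π f).f (n + 1) ≫ t = w :=
    ⟨(hSn (n + 1)).exact.desc w hw₁, (hSn (n + 1)).exact.g_desc _ _⟩
  have ht' : M.d n (n + 1) ≫ t = φ := by
    rw [← cancel_epi ((cokernel.π f).f n), Hom.comm_assoc, ht, hw₂]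
  rw [exactAt_iff_exact_up_to_refinements _ (n - 1) n (n + 1) (by simp) (by simp)]
  intro Z x hx
  rw [← comp_pOpcycles_eq_zero_iff_up_to_refinements _ _ _ (by simp),
    ← cancel_mono (Injective.ι (M.opcycles n)), Category.assoc]
  change x ≫ φ = _
  rw [← ht', reassoc_of% hx, zero_comp, zero_comp]

end Abelian

end KInjectiveResolution

namespace KInjectiveResolution

open CategoryTheory Limits HomologicalComplex ZeroObject

section Abelian

variable {A : Type u} [Category.{v} A] [Abelian A]

/-- The map from a disk induced by a morphism in degree `n`. -/
noncomputable def fromDisk {G : A} {Y : CochainComplex A ℤ} {n : ℤ} (g : G ⟶ Y.X n) :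
    disk G n ⟶ Y :=
  mkHomFromDouble _ (by lia) g (g ≫ Y.d n (n + 1)) (by simp) (by simp)

lemma fromDisk_f {G : A} {Y : CochainComplex A ℤ} {n : ℤ} (g : G ⟶ Y.X n) :
    (doubleXIso₀ _ _).inv ≫ (fromDisk g).f n = g := by
  simp [fromDisk]

/-- The cycles of `Q` in the image of `b` are boundaries of elements in the image of `b'`. -/
def Bounds {L L' Q : CochainComplex A ℤ} (b : L ⟶ Q) (b' : L' ⟶ Q) : Prop :=
  ∀ (n : ℤ) ⦃Z : A⦄ (z : Z ⟶ L.X (n + 1)), z ≫ b.f (n + 1) ≫ Q.d (n + 1) (n + 2) = 0 →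
    z ≫ b.f (n + 1) ≫ cokernel.π (b'.f n ≫ Q.d n (n + 1)) = 0

lemma comp_cokernelπ_eq_zero {L L' M Q : CochainComplex A ℤ} (u : L ⟶ M) (u' : L' ⟶ M)
    (b : M ⟶ Q) {n : ℤ} {Z : A} {z : Z ⟶ L.X (n + 1)}
    (h : z ≫ (u ≫ b).f (n + 1) ≫ cokernel.π ((u' ≫ b).f n ≫ Q.d n (n + 1)) = 0) :
    z ≫ u.f (n + 1) ≫ b.f (n + 1) ≫ cokernel.π (b.f n ≫ Q.d n (n + 1)) = 0 := by
  have h3 : ((u' ≫ b).f n ≫ Q.d n (n + 1)) ≫ cokernel.π (b.f n ≫ Q.d n (n + 1)) = 0 := by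
    have := u'.f n ≫= cokernel.condition (b.f n ≫ Q.d n (n + 1))
    simpa only [comp_f, Category.assoc, comp_zero] using this
  have h4 := h =≫ cokernel.desc _ _ h3
  rw [Category.assoc, Category.assoc, cokernel.π_desc, comp_f, Category.assoc, zero_comp] at h4
  exact h4

lemma acyclic_of_bounds {L M Q : CochainComplex A ℤ} (ρ : L ⟶ M) (m : M ⟶ Q) [Epi ρ] [Mono m]
    (h : Bounds (ρ ≫ m) (ρ ≫ m)) : M.Acyclic := by
  intro n
  obtain ⟨n, rfl⟩ : ∃ k, n = k + 1 := ⟨n - 1, by lia⟩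
  rw [exactAt_iff_exact_up_to_refinements _ n (n + 1) (n + 2) (by simp) (by simp; lia)]
  intro Z x hx
  obtain ⟨Z', π, _, y, hy⟩ := surjective_up_to_refinements_of_epi (ρ.f (n + 1)) x
  have h1 : y ≫ (ρ ≫ m).f (n + 1) ≫ Q.d (n + 1) (n + 2) = 0 := by
    rw [comp_f, Category.assoc, ← reassoc_of% hy, m.comm, reassoc_of% hx, zero_comp, comp_zero]
  have h2 := h n y h1
  have hS := ShortComplex.exact_cokernel ((ρ ≫ m).f n ≫ Q.d n (n + 1))
  rw [ShortComplex.exact_iff_exact_up_to_refinements] at hS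
  obtain ⟨Z'', π', _, t, ht⟩ := hS (y ≫ (ρ ≫ m).f (n + 1)) (by simpa using h2)
  refine ⟨Z'', π' ≫ π, inferInstance, t ≫ ρ.f n, ?_⟩
  rw [← cancel_mono (m.f (n + 1))]
  dsimp at ht
  simp only [Category.assoc, reassoc_of% hy]
  simpa using ht

lemma exists_bounds {G : A} (hG : IsSeparator G) {L L' Y Q : CochainComplex A ℤ}
    (a : L ⟶ Y) (q : Y ⟶ Q) [Epi q] (hQ : Q.Acyclic) :
    ∃ c : ∀ (n : ℤ), Subobject (L.X (n + 1)) → (G ⟶ Y.X n),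
      ∀ (a' : L' ⟶ Y), (∀ n S, ∃ d : G ⟶ L'.X n, d ≫ a'.f n = c n S) →
        Bounds (a ≫ q) (a' ≫ q) := by
  let b := a ≫ q
  let K (n : ℤ) : A := kernel (b.f (n + 1) ≫ Q.d (n + 1) (n + 2))
  let i (n : ℤ) : K n ⟶ L.X (n + 1) := kernel.ι _
  have hi (n : ℤ) : i n ≫ b.f (n + 1) ≫ Q.d (n + 1) (n + 2) = 0 := kernel.condition _
  let P (n : ℤ) : A := pullback (i n ≫ b.f (n + 1)) (q.f n ≫ Q.d n (n + 1))
  let pf (n : ℤ) : P n ⟶ K n := pullback.fst _ _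
  let ps (n : ℤ) : P n ⟶ Y.X n := pullback.snd _ _
  have hP (n : ℤ) : pf n ≫ i n ≫ b.f (n + 1) = ps n ≫ q.f n ≫ Q.d n (n + 1) :=
    pullback.condition
  have hpf (n : ℤ) : Epi (pf n) := by
    rw [epi_iff_surjective_up_to_refinements]
    intro Z z
    have h1 := hQ (n + 1)
    rw [exactAt_iff_exact_up_to_refinements _ n (n + 1) (n + 2) (by simp) (by simp; lia)] at h1
    obtain ⟨Z', π, _, x, hx⟩ := h1 (z ≫ i n ≫ b.f (n + 1))
      (by simp only [Category.assoc, hi, comp_zero])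
    obtain ⟨Z'', π', _, y, hy⟩ := surjective_up_to_refinements_of_epi (q.f n) x
    refine ⟨Z'', π' ≫ π, inferInstance, pullback.lift (π' ≫ π ≫ z) y ?_, ?_⟩
    · simp only [Category.assoc, hx, ← reassoc_of% hy]
    · simp only [pf, pullback.lift_fst, Category.assoc]
  let B (n : ℤ) (g : G ⟶ P n) : Subobject (L.X (n + 1)) := imageSubobject (g ≫ pf n ≫ i n)
  classical
  let c (n : ℤ) (S : Subobject (L.X (n + 1))) : G ⟶ Y.X n :=
    if h : ∃ g : G ⟶ P n, B n g = S then h.choose ≫ ps n else 0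
  refine ⟨c, fun a' key n Z z hz ↦ ?_⟩
  let r := cokernel.π ((a' ≫ q).f n ≫ Q.d n (n + 1))
  have hr : a'.f n ≫ q.f n ≫ Q.d n (n + 1) ≫ r = 0 := by
    have : a'.f n ≫ q.f n ≫ Q.d n (n + 1) = (a' ≫ q).f n ≫ Q.d n (n + 1) := by
      rw [comp_f, Category.assoc]
    rw [reassoc_of% this]
    exact (Category.assoc _ _ _).symm.trans (cokernel.condition _)
  have h2 (g : G ⟶ P n) : g ≫ pf n ≫ i n ≫ b.f (n + 1) ≫ r = 0 := by
    have h : ∃ g' : G ⟶ P n, B n g' = B n g := ⟨g, rfl⟩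
    obtain ⟨d, hd⟩ := key n (B n g)
    have hd' : d ≫ a'.f n = h.choose ≫ ps n := by simp only [hd, c, dif_pos h]
    have h3 : h.choose ≫ pf n ≫ i n ≫ b.f (n + 1) ≫ r = 0 := by
      rw [reassoc_of% (hP n), ← reassoc_of% hd', hr, comp_zero]
    have h4 : (B n h.choose).arrow ≫ b.f (n + 1) ≫ r = 0 := by
      rw [← cancel_epi (factorThruImageSubobject (h.choose ≫ pf n ≫ i n))]
      simpa only [B, imageSubobject_arrow_comp_assoc, Category.assoc, comp_zero] using h3
    rw [h.choose_spec] at h4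
    have h5 := factorThruImageSubobject (g ≫ pf n ≫ i n) ≫= h4
    simpa only [B, imageSubobject_arrow_comp_assoc, Category.assoc, comp_zero] using h5
  have h3 : i n ≫ b.f (n + 1) ≫ r = 0 := by
    rw [← cancel_epi (pf n), comp_zero]
    exact hG.def _ _ (fun g ↦ by rw [comp_zero]; exact h2 g)
  have h4 : kernel.lift _ z hz ≫ i n = z := kernel.lift_ι _ _ _
  change z ≫ b.f (n + 1) ≫ r = 0
  rw [← h4, Category.assoc, h3, comp_zero]

end Abelian

section Small

variable {A : Type u} [Category.{v} A] [Abelian A] [IsGrothendieckAbelian.{w} A]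

lemma hasColimitsOfShape_nat : HasColimitsOfShape ℕ A :=
  have : HasColimitsOfSize.{0, 0} A := hasColimitsOfSizeShrink.{0, 0, w, w} A
  inferInstance

lemma hasExactColimitsOfShape_nat :
    haveI := hasColimitsOfShape_nat.{w} (A := A)
    HasExactColimitsOfShape ℕ A :=
  have : HasColimitsOfSize.{0, 0} A := hasColimitsOfSizeShrink.{0, 0, w, w} A
  have : AB5OfSize.{0, 0} A := AB5OfSize_of_univLE.{0, 0, w, w} A
  inferInstance

/-- Any complex `L` can be enlarged by disks on `G`. -/
lemma exists_adjoinDisks (G : A) (L : CochainComplex A ℤ) :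
    ∃ (L' : CochainComplex A ℤ) (j : L ⟶ L'),
      ∀ (Y : CochainComplex A ℤ) (a : L ⟶ Y)
        (c : ∀ (n : ℤ), Subobject (L.X (n + 1)) → (G ⟶ Y.X n)),
        ∃ a' : L' ⟶ Y, j ≫ a' = a ∧ ∀ n S, ∃ d : G ⟶ L'.X n, d ≫ a'.f n = c n S := by
  let T := Shrink.{w} (Σ n : ℤ, Subobject (L.X (n + 1)))
  let e : T ≃ Σ n : ℤ, Subobject (L.X (n + 1)) := (equivShrink _).symm
  let D (t : T) := disk G (e t).1
  refine ⟨L ⊞ ∐ D, biprod.inl, fun Y a c ↦ ?_⟩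
  let a' : L ⊞ ∐ D ⟶ Y := biprod.desc a (Sigma.desc fun t ↦ fromDisk (c (e t).1 (e t).2))
  have ha' (t : T) : (Sigma.ι D t ≫ biprod.inr) ≫ a' = fromDisk (c (e t).1 (e t).2) := by
    simp [a']
  refine ⟨a', by simp [a'], fun n S ↦ ?_⟩
  have h (t : T) : ∃ d : G ⟶ (L ⊞ ∐ D).X (e t).1, d ≫ a'.f _ = c (e t).1 (e t).2 := by
    refine ⟨(doubleXIso₀ _ _).inv ≫ (Sigma.ι D t ≫ biprod.inr).f _, ?_⟩
    rw [Category.assoc, ← comp_f, ha', fromDisk_f]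
  generalize a' = a'' at *
  obtain ⟨t, ht⟩ := e.surjective ⟨n, S⟩
  have := h t
  rw [ht] at this
  exact this

lemma exists_enlarge {G : A} (hG : IsSeparator G) (L : CochainComplex A ℤ) :
    ∃ (L' : CochainComplex A ℤ) (j : L ⟶ L'),
      ∀ ⦃Y Q : CochainComplex A ℤ⦄ (a : L ⟶ Y) (q : Y ⟶ Q), Epi q → Q.Acyclic →
        ∃ a' : L' ⟶ Y, j ≫ a' = a ∧ Bounds (a ≫ q) (a' ≫ q) := by
  obtain ⟨L', j, h⟩ := exists_adjoinDisks.{w} G L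
  refine ⟨L', j, fun Y Q a q _ hQ ↦ ?_⟩
  obtain ⟨c, hc⟩ := exists_bounds hG (L' := L') a q hQ
  obtain ⟨a', h1, h2⟩ := h Y a c
  exact ⟨a', h1, hc a' h2⟩

lemma exists_enlargeSeq {G : A} (hG : IsSeparator G) (L : CochainComplex A ℤ) :
    ∃ (E : ℕ → CochainComplex A ℤ) (j : ∀ k, E k ⟶ E (k + 1)) (j₀ : L ⟶ E 0),
      ∀ ⦃Y Q : CochainComplex A ℤ⦄ (a : L ⟶ Y) (q : Y ⟶ Q), Epi q → Q.Acyclic →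
        ∃ α : ∀ k, E k ⟶ Y, j₀ ≫ α 0 = a ∧ (∀ k, j k ≫ α (k + 1) = α k) ∧
          ∀ k, Bounds (α k ≫ q) (α (k + 1) ≫ q) := by
  choose E j h using exists_enlarge.{w} hG (A := A)
  let E' (k : ℕ) : CochainComplex A ℤ := Nat.rec L (fun _ M ↦ E M) k
  refine ⟨E', fun k ↦ j (E' k), 𝟙 L, fun Y Q a q hq hQ ↦ ?_⟩
  choose α h1 h2 using fun M b ↦ h M b q hq hQ
  let α' (k : ℕ) : E' k ⟶ Y := Nat.rec (motive := fun k ↦ E' k ⟶ Y) a (fun k b ↦ α (E' k) b) k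
  exact ⟨α', Category.id_comp _, fun k ↦ h1 (E' k) (α' k), fun k ↦ h2 (E' k) (α' k)⟩

lemma bounds_of_isColimit {F : ℕ ⥤ CochainComplex A ℤ} {c : Cocone F} (hc : IsColimit c)
    {Q : CochainComplex A ℤ} (b : c.pt ⟶ Q)
    (h : ∀ k, Bounds (c.ι.app k ≫ b) (c.ι.app (k + 1) ≫ b)) : Bounds b b := by
  have := hasColimitsOfShape_nat.{w} (A := A)
  have := hasExactColimitsOfShape_nat.{w} (A := A)
  intro n Z z hz
  let F' := F ⋙ eval A (.up ℤ) (n + 1)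
  let cF : Cocone F' := (eval A (.up ℤ) (n + 1)).mapCocone c
  have hcF : IsColimit cF := isColimitOfPreserves _ hc
  let f := b.f (n + 1) ≫ Q.d (n + 1) (n + 2)
  let β : F' ⟶ (Functor.const ℕ).obj (Q.X (n + 2)) := cF.ι ≫ (Functor.const ℕ).map f
  have hβ (k : ℕ) : β.app k = cF.ι.app k ≫ f := rfl
  let cK : Cocone (kernel β) := (Cocone.precompose (kernel.ι β)).obj cF
  have hex := colim.exact_mapShortComplex
    (S := ShortComplex.mk (kernel.ι β) β (kernel.condition β))
    (ShortComplex.exact_kernel β) (colimit.isColimit (kernel β)) hcF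
    (isColimitConstCocone ℕ (Q.X (n + 2)))
    (colimit.desc (kernel β) cK) f
    (fun k ↦ by simp [cK]) (fun k ↦ by
      rw [hβ]
      exact (Category.comp_id _).symm)
  rw [ShortComplex.exact_iff_exact_up_to_refinements] at hex
  obtain ⟨Z', π, _, x, hx⟩ : ∃ (Z' : A) (π : Z' ⟶ Z) (_ : Epi π) (x : Z' ⟶ colimit (kernel β)),
    π ≫ z = x ≫ colimit.desc (kernel β) cK := hex z hz
  rw [← cancel_epi π, comp_zero]
  let r := cokernel.π (b.f n ≫ Q.d n (n + 1))
  have hr : colimit.desc (kernel β) cK ≫ b.f (n + 1) ≫ r = 0 := by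
    apply colimit.hom_ext
    intro k
    rw [colimit.ι_desc_assoc, comp_zero]
    have h1 : (kernel.ι β).app k ≫ β.app k = 0 := by
      rw [← NatTrans.comp_app, kernel.condition]; rfl
    have h2 := h k n ((kernel.ι β).app k) (by
      rw [hβ] at h1
      rw [comp_f, Category.assoc]
      exact h1)
    exact (Category.assoc _ _ _).trans (comp_cokernelπ_eq_zero _ _ _ h2)
  exact (Category.assoc _ _ _).symm.trans ((congr_arg (· ≫ b.f (n + 1) ≫ r) hx).trans
    ((Category.assoc _ _ _).trans ((congr_arg (x ≫ ·) hr).trans comp_zero)))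

lemma exists_enlargeColim {G : A} (hG : IsSeparator G) (m : ℤ) :
    ∃ (L : CochainComplex A ℤ),
      ∀ ⦃Y Q : CochainComplex A ℤ⦄ (q : Y ⟶ Q), Epi q → Q.Acyclic →
        ∀ g : G ⟶ Y.X m, g ≫ q.f m ≠ 0 →
        ∃ a : L ⟶ Y, a ≫ q ≠ 0 ∧ Bounds (a ≫ q) (a ≫ q) := by
  have := hasColimitsOfShape_nat.{w} (A := A)
  obtain ⟨E, j, j₀, h⟩ := exists_enlargeSeq.{w} hG (disk G m)
  refine ⟨colimit (Functor.ofSequence j), fun Y Q q hq hQ g hg ↦ ?_⟩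
  obtain ⟨α, h0, h1, h2⟩ := h (fromDisk g) q hq hQ
  let c : Cocone (Functor.ofSequence j) := Cocone.mk Y
    (NatTrans.ofSequence α (fun k ↦ by
      rw [Functor.ofSequence_map_homOfLE_succ]
      exact (h1 k).trans (Category.comp_id _).symm))
  let a : colimit (Functor.ofSequence j) ⟶ Y := colimit.desc _ c
  have ha (k : ℕ) : colimit.ι (Functor.ofSequence j) k ≫ a = α k := colimit.ι_desc _ _
  have ha' (k : ℕ) : colimit.ι (Functor.ofSequence j) k ≫ a ≫ q = α k ≫ q := by
    rw [← Category.assoc, ha]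
    rfl
  refine ⟨a, fun h ↦ hg ?_, bounds_of_isColimit (colimit.isColimit _) _ fun k ↦ ?_⟩
  · have h3 : α 0 ≫ q = 0 := by
      rw [← ha', h]
      exact comp_zero
    rw [← fromDisk_f g, ← h0, Category.assoc, ← comp_f, Category.assoc, h3, comp_zero, zero_f,
      comp_zero]
  · have h3 := h2 k
    rw [← ha' k, ← ha' (k + 1)] at h3
    exact h3

end Small

end KInjectiveResolution

namespace KInjectiveResolution

open CategoryTheory Limits

section Transfinite

variable {C : Type u} [Category.{v} C] [Abelian C] [IsGrothendieckAbelian.{w} C] {Y : C} {φ : Subobject Y → Subobject Y}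
  (hφ : ∀ B, B ≤ φ B) (B₀ : Subobject Y)
  (J : Type w) [LinearOrder J] [OrderBot J] [SuccOrder J] [WellFoundedLT J]

/-- The transfinite iteration of `φ`, as a functor to subobjects. -/
noncomputable def iterToMonoOver : J ⥤ MonoOver Y where
  obj j := MonoOver.mk (transfiniteIterate φ j B₀).arrow
  map {j j'} f := MonoOver.homMk (Subobject.ofLE _ _
      (monotone_transfiniteIterate _ _ hφ (leOfHom f)))

/-- The transfinite iteration of `φ`, as a functor. -/
noncomputable def iter : J ⥤ C where
  obj j := ((transfiniteIterate φ j B₀ : Subobject Y) : C)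
  map f := Subobject.ofLE _ _ (monotone_transfiniteIterate _ _ hφ (leOfHom f))
  map_id _ := Subobject.ofLE_refl _
  map_comp _ _ := (Subobject.ofLE_comp_ofLE _ _ _ _ _).symm

instance : (iter hφ B₀ J).IsWellOrderContinuous where
  nonempty_isColimit m hm := ⟨by
    have := hm.nonempty_Iio.to_subtype
    let c := (Set.principalSegIio m).cocone (iterToMonoOver hφ B₀ J ⋙ MonoOver.forget _)
    have : Mono c.pt.hom := inferInstanceAs (Mono (transfiniteIterate φ m B₀).arrow)
    apply IsGrothendieckAbelian.isColimitMapCoconeOfSubobjectMkEqISup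
      ((Set.principalSegIio m).monotone.functor ⋙ iterToMonoOver hφ B₀ J) c
    change Subobject.mk (transfiniteIterate φ m B₀).arrow =
      ⨆ j, Subobject.mk (transfiniteIterate φ _ B₀).arrow
    simp only [Subobject.mk_arrow]
    exact transfiniteIterate_limit φ B₀ m hm⟩

variable {J}

/-- The inclusion in a step of the transfinite iteration is a transfinite composition. -/
noncomputable def iterTransfiniteComposition (T : MorphismProperty C) (j : J)
    (hT : ∀ k < j, T (Subobject.ofLE _ _ (hφ (transfiniteIterate φ k B₀)))) :
    T.TransfiniteCompositionOfShape (Set.Iic j) ((iter hφ B₀ J).map (homOfLE bot_le : ⊥ ⟶ j)) where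
  F := (Set.initialSegIic j).monotone.functor ⋙ iter hφ B₀ J
  isoBot := Iso.refl _
  incl :=
    { app k := (iter hφ B₀ J).map (homOfLE k.2)
      naturality k k' h := by
        simp only [Functor.comp_map, Functor.const_obj_map, ← Functor.map_comp]
        exact (Category.comp_id _).symm }
  isColimit := colimitOfDiagramTerminal isTerminalTop _
  map_mem k hk := by
    have hk' : k.1 < j := by
      refine lt_of_le_of_ne k.2 fun h ↦ hk ?_
      intro l _
      exact (show l.1 ≤ k.1 from le_of_le_of_eq l.2 h.symm)
    have h1 : transfiniteIterate φ (Order.succ k).1 B₀ = φ (transfiniteIterate φ k.1 B₀) := by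
      rw [Set.Iic.succ_eq_of_not_isMax hk,
        transfiniteIterate_succ _ _ _ (Set.not_isMax_coe _ hk)]
    have h2 (B B' : Subobject Y) (h : B ≤ B') (h' : B' = φ B) (hB : T (Subobject.ofLE _ _ (hφ B))) :
        T (Subobject.ofLE _ _ h) := by
      subst h'
      exact hB
    exact h2 _ _ _ h1 (hT k.1 hk')
  fac := Category.id_comp _

end Transfinite

section Generation

variable {C : Type u} [Category.{v} C] [Abelian C] [IsGrothendieckAbelian.{w} C]

lemma le_llp_of_exists (T W : MorphismProperty C) [W.RespectsIso]
    (hT : ∃ S : MorphismProperty C, T = S.llp)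
    (h1 : ∀ ⦃Y : C⦄ (B : Subobject Y), W B.arrow → B ≠ ⊤ →
      ∃ (B' : Subobject Y) (h : B < B'), T (Subobject.ofLE B B' h.le))
    (h2 : ∀ ⦃X X' Y : C⦄ (i : X ⟶ X') (p : X' ⟶ Y), T i → Mono p → W (i ≫ p) → W p)
    {X Y : C} (f : X ⟶ Y) [Mono f] (hf : W f) : T f := by
  classical
  let φ (B : Subobject Y) : Subobject Y :=
    if h : W B.arrow ∧ B ≠ ⊤ then (h1 B h.1 h.2).choose else ⊤
  have lt_φ (B : Subobject Y) (hB : B ≠ ⊤) : B < φ B := by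
    by_cases h : W B.arrow
    · simp only [φ, dif_pos (And.intro h hB)]
      exact (h1 B h hB).choose_spec.choose
    · simp only [φ, h, false_and, dite_false]
      exact lt_top_iff_ne_top.2 hB
  have φ_top : φ ⊤ = ⊤ := by simp [φ]
  have le_φ (B : Subobject Y) : B ≤ φ B := by
    by_cases hB : B = ⊤
    · rw [hB, φ_top]
    · exact (lt_φ B hB).le
  have hTφ (B : Subobject Y) (hB : W B.arrow) : T (Subobject.ofLE _ _ (le_φ B)) := by
    have h3 (B' : Subobject Y) (h : B ≤ B') (h' : φ B = B') (hB : T (Subobject.ofLE _ _ h)) :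
        T (Subobject.ofLE _ _ (le_φ B)) := by
      subst h'
      exact hB
    by_cases h : B = ⊤
    · refine h3 B le_rfl (by rw [h, φ_top]) ?_
      obtain ⟨S, rfl⟩ := hT
      rw [Subobject.ofLE_refl]
      exact S.llp.id_mem _
    · exact h3 _ _ (dif_pos (And.intro hB h)) (h1 B hB h).choose_spec.choose_spec
  let κ := Order.succ (Cardinal.mk (Shrink.{w} (Subobject Y)))
  have : Nonempty κ.ord.ToType := by simp [κ]
  have := WellFoundedLT.toOrderBot κ.ord.ToType
  let J := κ.ord.ToType
  have hJ : HasCardinalLT (Subobject Y) (Cardinal.mk J) :=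
    lt_of_lt_of_le (Order.lt_succ _) (by simp [κ, J])
  obtain ⟨j, hj⟩ : ∃ (j : J), transfiniteIterate φ j (Subobject.mk f) = ⊤ :=
    top_mem_range_transfiniteIterate φ (Subobject.mk f) lt_φ φ_top
      (fun h ↦ by simpa [hasCardinalLT_iff_cardinal_mk_lt] using hJ.of_injective _ h)
  have hTj (j : J) (hj : ∀ k < j, W (transfiniteIterate φ k (Subobject.mk f)).arrow) :
      T ((iter le_φ (Subobject.mk f) J).map (homOfLE bot_le : ⊥ ⟶ j)) := by
    have h := (iterTransfiniteComposition le_φ (Subobject.mk f) T j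
      (fun k hk ↦ hTφ _ (hj k hk))).mem
    obtain ⟨S, rfl⟩ := hT
    exact MorphismProperty.transfiniteCompositionsOfShape_le _ _ _ h
  have hbot : W (transfiniteIterate φ (⊥ : J) (Subobject.mk f)).arrow := by
    rw [transfiniteIterate_bot]
    exact (W.arrow_mk_iso_iff (Arrow.isoMk (Subobject.underlyingIso f) (Iso.refl _) (by simp))).2 hf
  have hW (j : J) : W (transfiniteIterate φ j (Subobject.mk f)).arrow := by
    induction j using WellFoundedLT.induction with
    | ind j hj =>
      refine h2 _ _ (hTj j hj) inferInstance ?_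
      have h (g) (hg : g = (transfiniteIterate φ (⊥ : J) (Subobject.mk f)).arrow) : W g := by
        rw [hg]
        exact hbot
      exact h _ (Subobject.ofLE_arrow _)
  have h4 := hTj j (fun k _ ↦ hW k)
  have : IsIso (transfiniteIterate φ j (Subobject.mk f)).arrow :=
    (Subobject.isIso_arrow_iff_eq_top _).2 hj
  let e : ((transfiniteIterate φ j (Subobject.mk f) : Subobject Y) : C) ≅ Y := asIso (Subobject.arrow _)
  obtain ⟨S, rfl⟩ := hT
  refine (S.llp.arrow_mk_iso_iff (Arrow.isoMk ((Subobject.isoOfEq _ _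
    (transfiniteIterate_bot φ (Subobject.mk f)) ≪≫ Subobject.underlyingIso f))
    e ?_)).1 h4
  have h5 : (iter le_φ (Subobject.mk f) J).map (homOfLE bot_le : ⊥ ⟶ j) ≫
        (transfiniteIterate φ j (Subobject.mk f)).arrow =
          (transfiniteIterate φ (⊥ : J) (Subobject.mk f)).arrow := Subobject.ofLE_arrow _
  refine Eq.trans ?_ h5.symm
  simp

end Generation

end KInjectiveResolution

namespace KInjectiveResolution

open CategoryTheory Limits HomologicalComplex ZeroObject MorphismProperty

section Generators

variable {A : Type u} [Category.{v} A] [Abelian A]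

/-- A set of acyclic monomorphisms: the inclusions of subobjects of quotients of the
complexes `L m`. -/
def generators (L : ℤ → CochainComplex A ℤ) : MorphismProperty (CochainComplex A ℤ) :=
  MorphismProperty.ofHoms (fun t : {t : Σ (m : ℤ) (R : Subobject (L m)),
    Subobject (cokernel R.arrow) // acyclicMono t.2.2.arrow} ↦ t.1.2.2.arrow)

lemma generators_le (L : ℤ → CochainComplex A ℤ) : generators L ≤ acyclicMono := by
  rintro _ _ _ ⟨t⟩
  exact t.2

instance : (acyclicMono (A := A)).RespectsIso :=
  RespectsIso.of_respects_arrow_iso _ (fun f g e hf ↦ by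
    have := hf.1
    have := hf.2
    refine ⟨?_, ?_⟩
    · exact ((monomorphisms _).arrow_mk_iso_iff e).1 hf.1
    · exact (quasiIso_iff_of_arrow_mk_iso f.hom g.hom e).1 hf.2)

lemma exists_pushouts (G : A) (hG : IsSeparator G) (L : ℤ → CochainComplex A ℤ)
    (hL : ∀ m, ∀ ⦃Y Q : CochainComplex A ℤ⦄ (q : Y ⟶ Q), Epi q → Q.Acyclic →
        ∀ g : G ⟶ Y.X m, g ≫ q.f m ≠ 0 →
        ∃ a : L m ⟶ Y, a ≫ q ≠ 0 ∧ Bounds (a ≫ q) (a ≫ q))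
    {X Y : CochainComplex A ℤ} (p : X ⟶ Y) [Mono p] (hp : acyclicMono p) (hp' : ¬ IsIso p) :
    ∃ (X' : CochainComplex A ℤ) (i : X ⟶ X') (p' : X' ⟶ Y) (_ : (generators L).pushouts i)
      (_ : ¬ IsIso i) (_ : Mono p'), i ≫ p' = p := by
  let q := cokernel.π p
  have hq : p ≫ q = 0 := cokernel.condition p
  have hpq : (ShortComplex.mk p q hq).Exact := ShortComplex.exact_cokernel p
  have hQ : (cokernel p).Acyclic := hp.acyclic_cokernel
  obtain ⟨m, hm⟩ : ∃ m, q.f m ≠ 0 := by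
    by_contra! h
    have h0 : q = 0 := by
      ext n
      exact h n
    have : Epi p := hpq.epi_f h0
    exact hp' (isIso_of_mono_of_epi p)
  obtain ⟨g, hg⟩ : ∃ g : G ⟶ Y.X m, g ≫ q.f m ≠ 0 := by
    by_contra! h
    exact hm (hG.def _ _ (fun g ↦ by rw [h, comp_zero]))
  obtain ⟨a, ha, ha'⟩ := hL m q inferInstance hQ g hg
  let R := Subobject.mk (kernel.ι a)
  have hR : R.arrow ≫ a = 0 := by
    rw [← cancel_epi (Subobject.underlyingIso (kernel.ι a)).inv]
    simp [R]
  have hRex : (ShortComplex.mk R.arrow a hR).Exact := by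
    rw [ShortComplex.exact_iff_exact_up_to_refinements]
    intro Z z hz
    refine ⟨Z, 𝟙 Z, inferInstance, kernel.lift a z hz ≫ (Subobject.underlyingIso _).inv, ?_⟩
    simp [R]
  let n : cokernel R.arrow ⟶ Y := cokernel.desc R.arrow a hR
  have hn : cokernel.π R.arrow ≫ n = a := cokernel.π_desc _ _ _
  have : Mono n := hRex.mono_cokernelDesc
  let i' := pullback.snd p n
  have hi' : i' ≫ n ≫ q = 0 := by
    rw [← pullback.condition_assoc, hq, comp_zero]
  have hi'ex : (ShortComplex.mk i' (n ≫ q) hi').Exact := by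
    rw [ShortComplex.exact_iff_exact_up_to_refinements]
    intro Z z hz
    have hz' : (z ≫ n) ≫ q = 0 := by simpa using hz
    refine ⟨Z, 𝟙 Z, inferInstance, pullback.lift (hpq.lift (z ≫ n) hz') z
      (hpq.lift_f _ _), ?_⟩
    rw [Category.id_comp]
    exact (pullback.lift_snd _ _ _).symm
  have hacyc : acyclicMono i' := by
    refine ⟨inferInstance, quasiIso_of_acyclic_cokernel _ ?_⟩
    have : Mono (cokernel.desc i' (n ≫ q) hi') := hi'ex.mono_cokernelDesc
    refine acyclic_of_bounds (cokernel.π R.arrow ≫ cokernel.π i')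
      (cokernel.desc i' (n ≫ q) hi') ?_
    have h : (cokernel.π R.arrow ≫ cokernel.π i') ≫ cokernel.desc i' (n ≫ q) hi' = a ≫ q := by
      rw [Category.assoc, cokernel.π_desc, reassoc_of% hn]
    rw [h]
    exact ha'
  have hacyc' : acyclicMono (Subobject.mk i').arrow :=
    (acyclicMono.arrow_mk_iso_iff
      (Arrow.isoMk (Subobject.underlyingIso i') (Iso.refl _) (by simp))).2 hacyc
  have hgen : generators L (Subobject.mk i').arrow :=
    MorphismProperty.ofHoms.mk (f := fun t : {t : Σ (m : ℤ) (R : Subobject (L m)),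
      Subobject (cokernel R.arrow) // acyclicMono t.2.2.arrow} ↦ t.1.2.2.arrow)
      ⟨⟨m, R, Subobject.mk i'⟩, hacyc'⟩
  have hpush : IsPushout ((Subobject.underlyingIso i').hom ≫ pullback.fst p n)
      (Subobject.mk i').arrow (pushout.inl (pullback.fst p n) (pullback.snd p n))
      (pushout.inr (pullback.fst p n) (pullback.snd p n)) :=
    (IsPushout.of_hasPushout (pullback.fst p n) (pullback.snd p n)).of_iso
      ((Subobject.underlyingIso _).symm) (Iso.refl _) (Iso.refl _)
      (Iso.refl _) (by simp) (by simp [i'])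
      ((Category.comp_id _).trans (Category.id_comp _).symm)
      ((Category.comp_id _).trans (Category.id_comp _).symm)
  refine ⟨pushout (pullback.fst p n) (pullback.snd p n), pushout.inl _ _,
    pushout.desc p n pullback.condition, ⟨_, _, _, _, _, hgen, hpush⟩, ?_, ?_,
    pushout.inl_desc _ _ _⟩
  · intro h
    apply ha
    have h1 : n = (pushout.inr (pullback.fst p n) (pullback.snd p n) ≫
      inv (pushout.inl (pullback.fst p n) (pullback.snd p n))) ≫ p := by
      have : inv (pushout.inl (pullback.fst p n) (pullback.snd p n)) ≫ p =
          pushout.desc p n pullback.condition := by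
        rw [IsIso.inv_comp_eq, pushout.inl_desc]
      rw [Category.assoc, this, pushout.inr_desc]
    rw [← hn, Category.assoc, h1, Category.assoc, hq, comp_zero, comp_zero]
  · exact (IsPushout.of_hasPushout _ _).mono_of_isPullback_of_mono
      (IsPullback.of_hasPullback p n) _ (pushout.inl_desc _ _ _) (pushout.inr_desc _ _ _)

lemma isKInjective_of_rlp (I : CochainComplex A ℤ)
    (hI : acyclicMono.rlp (0 : I ⟶ 0)) : I.IsKInjective where
  nonempty_homotopy_zero {M} f hM := by
    let i := CochainComplex.mappingCone.inr (𝟙 M)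
    have h := CochainComplex.mappingCone.homotopyToZeroOfId M
    have hi : acyclicMono i := by
      constructor
      · have (n : ℤ) : Mono (i.f n) := by
          have : Mono (i.f n ≫ (CochainComplex.mappingCone.snd (𝟙 M)).v n n (add_zero n)) := by
            rw [CochainComplex.mappingCone.inr_f_snd_v]
            infer_instance
          exact mono_of_mono _ ((CochainComplex.mappingCone.snd (𝟙 M)).v n n (add_zero n))
        exact mono_of_mono_f i this
      · refine ⟨fun n ↦ ?_⟩
        rw [quasiIsoAt_iff_isIso_homologyMap]
        have h0 : IsZero (M.homology n) := (exactAt_iff_isZero_homology _ _).1 (hM n)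
        have h1 : IsZero ((CochainComplex.mappingCone (𝟙 M)).homology n) := by
          rw [IsZero.iff_id_eq_zero, ← homologyMap_id, h.homologyMap_eq n, homologyMap_zero]
        exact h0.isIso h1 _
    have sq : CommSq f i (0 : I ⟶ 0) 0 := ⟨by simp⟩
    have := hI i hi
    have hl : i ≫ sq.lift = f := sq.fac_left
    exact ⟨(Homotopy.ofEq (by simp [hl])).trans
      (((h.compRight sq.lift).compLeft i).trans (Homotopy.ofEq (by simp)))⟩

lemma exists_larger (G : A) (hG : IsSeparator G) (L : ℤ → CochainComplex A ℤ)
    (hL : ∀ m, ∀ ⦃Y Q : CochainComplex A ℤ⦄ (q : Y ⟶ Q), Epi q → Q.Acyclic →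
        ∀ g : G ⟶ Y.X m, g ≫ q.f m ≠ 0 →
        ∃ a : L m ⟶ Y, a ≫ q ≠ 0 ∧ Bounds (a ≫ q) (a ≫ q))
    {Y : CochainComplex A ℤ} (B : Subobject Y) (hB : acyclicMono B.arrow) (hB' : B ≠ ⊤) :
    ∃ (B' : Subobject Y) (h : B < B'), (generators L).rlp.llp (Subobject.ofLE B B' h.le) := by
  obtain ⟨X', i, p, hi, hi', _, fac⟩ := exists_pushouts G hG L hL B.arrow hB
    (fun h ↦ hB' ((Subobject.isIso_arrow_iff_eq_top _).1 h))
  have hlt : B < Subobject.mk p := by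
    have := Subobject.mk_lt_mk_of_comm i fac hi'
    rwa [Subobject.mk_arrow] at this
  refine ⟨Subobject.mk p, hlt, ?_⟩
  let e : CategoryTheory.Arrow.mk (Subobject.ofLE B (Subobject.mk p) hlt.le) ≅
      CategoryTheory.Arrow.mk i :=
    CategoryTheory.Arrow.isoMk (Iso.refl _) (Subobject.underlyingIso p) (by
      rw [← cancel_mono p]
      simp [fac])
  exact ((generators L).rlp.llp.arrow_mk_iso_iff e).2 (pushouts_le_llp_rlp _ _ hi)

end Generators

section Existence

variable {A : Type u} [Category.{v} A] [Abelian A] [IsGrothendieckAbelian.{w} A]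

lemma llp_rlp_generators_le (L : ℤ → CochainComplex A ℤ) :
    (generators L).rlp.llp ≤ acyclicMono := by
  intro X Y f hf
  have h1 : Mono f := by
    have h : (monomorphisms (CochainComplex A ℤ)).rlp ≤ (generators L).rlp :=
      antitone_rlp (fun _ _ _ h ↦ (generators_le L _ h).1)
    have := antitone_llp h _ hf
    rw [IsGrothendieckAbelian.llp_rlp_monomorphisms.{w}
      (isSeparator_separator (CochainComplex A ℤ))] at this
    exact this
  exact acyclicMono_of_llp f (antitone_llp
    ((le_llp_iff_le_rlp _ _).1 ((generators_le L).trans acyclicMono_le_llp)) _ hf)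

instance (L : ℤ → CochainComplex A ℤ) : MorphismProperty.IsSmall.{w} (generators L) := by
  dsimp [generators]
  infer_instance

instance hasSmallObjectArgument_generators (L : ℤ → CochainComplex A ℤ) :
    HasSmallObjectArgument.{w} (generators L) := by
  let ι := {t : Σ (m : ℤ) (R : Subobject (L m)),
    Subobject (cokernel R.arrow) // acyclicMono t.2.2.arrow}
  obtain ⟨κ, hκ', hκ⟩ := HasCardinalLT.exists_regular_cardinal_forall.{w}
    (fun t : ι ↦ Subobject (t.1.2.2 : CochainComplex A ℤ))
  have : Fact κ.IsRegular := ⟨hκ'⟩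
  have : Nonempty κ.ord.ToType := by simpa using hκ'.ne_zero
  have := WellFoundedLT.toOrderBot κ.ord.ToType
  exact ⟨κ, inferInstance, inferInstance,
    { preservesColimit {A₁ A₂ X Y} i hi f hf := by
        let hf' : (monomorphisms (CochainComplex A ℤ)).TransfiniteCompositionOfShape
            κ.ord.ToType f :=
          { toTransfiniteCompositionOfShape := hf.toTransfiniteCompositionOfShape
            map_mem j hj := by
              have := (hf.attachCells j hj).pushouts_coproducts
              simp only [ofHoms_homFamily] at this
              refine (?_ : _ ≤ monomorphisms _) _ this
              simp only [pushouts_le_iff, coproducts_le_iff]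
              exact fun _ _ _ h ↦ (generators_le L _ h).1 }
        have (j j' : κ.ord.ToType) (φ : j ⟶ j') : Mono (hf'.F.map φ) := hf'.mem_map φ
        apply IsGrothendieckAbelian.preservesColimit_coyoneda_obj_of_mono (Y := hf'.F) (κ := κ)
        obtain ⟨t⟩ := hi
        exact hκ t }⟩

variable (A) in
lemma exists_generators : ∃ (L : ℤ → CochainComplex A ℤ),
    acyclicMono ≤ (generators L).rlp.llp := by
  have hG := isSeparator_separator A
  choose L hL using exists_enlargeColim.{w} hG
  refine ⟨L, fun X Y f hf ↦ ?_⟩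
  have := hf.1
  refine le_llp_of_exists.{w} _ acyclicMono ⟨_, rfl⟩
    (fun Y B hB hB' ↦ exists_larger _ hG L hL B hB hB') ?_ f hf
  intro X X' Y i p hi _ hip
  have := hip.2
  have := (llp_rlp_generators_le.{w} L _ hi).2
  exact ⟨inferInstance, quasiIso_of_comp_left i p⟩

/-- Every complex in a Grothendieck abelian category has a K-injective replacement. -/
theorem exists_kInjective (K : CochainComplex A ℤ) :
    ∃ (I : CochainComplex A ℤ) (f : K ⟶ I), QuasiIso f ∧ I.IsKInjective := by
  obtain ⟨L, hL⟩ := exists_generators.{w} A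
  let fac := (functorialFactorizationData (generators L).rlp.llp (generators L).rlp).factorizationData
    (0 : K ⟶ 0)
  refine ⟨fac.Z, fac.i, (llp_rlp_generators_le.{w} L _ fac.hi).2, isKInjective_of_rlp _ ?_⟩
  have h := fac.hp
  rw [(isZero_zero (CochainComplex A ℤ)).eq_of_tgt fac.p 0] at h
  exact antitone_rlp hL _ ((le_llp_iff_le_rlp _ _).1 le_rfl _ h)

end Existence

end KInjectiveResolution

/-! ### The canonical isomorphism -/

namespace RefinedUnramified

open CategoryTheory Limits TopologicalSpace Opposite AlgebraicGeometry

section Hypercohomology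

variable {C : Type u} [SmallCategory C] (J : GrothendieckTopology C)

/-- The sheaves of abelian groups on a site. -/
abbrev AbSheaf : Type (u + 1) := Sheaf J AddCommGrpCat.{u}

instance hasCoproducts_abSheaf : HasCoproducts.{u} (AbSheaf J) :=
  fun _ ↦ (IsGrothendieckAbelian.hasColimits (AbSheaf J)).has_colimits_of_shape _

instance sheafSections_additive (U : Cᵒᵖ) :
    ((sheafSections J AddCommGrpCat.{u}).obj U).Additive where
  map_add := rfl

variable {J}

/-- A K-injective replacement of a complex of abelian sheaves. -/
noncomputable def injRepl (K : CochainComplex (AbSheaf J) ℤ) : CochainComplex (AbSheaf J) ℤ :=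
  (KInjectiveResolution.exists_kInjective.{u} K).choose

/-- The quasi-isomorphism from a complex to its K-injective replacement. -/
noncomputable def toInjRepl (K : CochainComplex (AbSheaf J) ℤ) : K ⟶ injRepl K :=
  (KInjectiveResolution.exists_kInjective.{u} K).choose_spec.choose

instance toInjRepl_quasiIso (K : CochainComplex (AbSheaf J) ℤ) : QuasiIso (toInjRepl K) :=
  (KInjectiveResolution.exists_kInjective.{u} K).choose_spec.choose_spec.1

instance injRepl_isKInjective (K : CochainComplex (AbSheaf J) ℤ) : (injRepl K).IsKInjective :=
  (KInjectiveResolution.exists_kInjective.{u} K).choose_spec.choose_spec.2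

variable (J) in
/-- The functor which sends a complex of sheaves `I` to the presheaf of complexes
`U ↦ Γ(U, I)`. -/
@[simps]
noncomputable def sectionsComplex :
    CochainComplex (AbSheaf J) ℤ ⥤ Cᵒᵖ ⥤ CochainComplex AddCommGrpCat.{u} ℤ where
  obj I :=
    { obj U := (((sheafSections J AddCommGrpCat.{u}).obj U).mapHomologicalComplex _).obj I
      map g := (NatTrans.mapHomologicalComplex ((sheafSections J AddCommGrpCat.{u}).map g) _).app I
      map_id U := by ext n : 1; simp
      map_comp g h := by ext n : 1; simp }
  map φ :=
    { app U := (((sheafSections J AddCommGrpCat.{u}).obj U).mapHomologicalComplex _).map φ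
      naturality U V g := by ext n : 1; simp }

/-- The presheaf `U ↦ Hⁱ(Γ(U, I))`, for a complex of sheaves `I`. -/
noncomputable def sectionsCohomology (I : CochainComplex (AbSheaf J) ℤ) (i : ℤ) :
    Cᵒᵖ ⥤ AddCommGrpCat.{u} :=
  (sectionsComplex J).obj I ⋙ HomologicalComplex.homologyFunctor _ _ i

/-- The map `Hⁱ(Γ(-, I)) ⟶ Hⁱ(Γ(-, I'))` induced by a morphism of complexes of sheaves. -/
noncomputable def sectionsCohomologyMap {I I' : CochainComplex (AbSheaf J) ℤ} (φ : I ⟶ I')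
    (i : ℤ) : sectionsCohomology I i ⟶ sectionsCohomology I' i :=
  Functor.whiskerRight ((sectionsComplex J).map φ) _

/-- The hypercohomology `Hⁱ(U, K) = RⁱΓ(U, K)`, as a presheaf in `U`. -/
noncomputable def hypercohomology (K : CochainComplex (AbSheaf J) ℤ) (i : ℤ) :
    Cᵒᵖ ⥤ AddCommGrpCat.{u} :=
  sectionsCohomology (injRepl K) i

end Hypercohomology

section Codimension

variable (X : Scheme.{u})

/-- A scheme is equidimensional if all its irreducible components have the same dimension. -/
def IsEquidimensional : Prop :=
  ∀ Z ∈ irreducibleComponents X, topologicalKrullDim Z = topologicalKrullDim X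

variable {X}

/-- The codimension `dim X - dim (closure {x})` of a point. Both dimensions are
nonnegative, so that the value of `unbotD` at `⊥` does not matter. -/
noncomputable def codim (x : X) : ℕ∞ :=
  (topologicalKrullDim X).unbotD 0 - (topologicalKrullDim (closure {x} : Set X)).unbotD 0

variable (X)

/-- The set of points `F_j X` of codimension at most `j`. -/
def F (j : ℤ) : Set X := {x | ∃ n : ℕ, codim x = n ∧ (n : ℤ) ≤ j}

lemma F_mono {j j' : ℤ} (h : j ≤ j') : F X j ⊆ F X j' := by
  rintro x ⟨n, hn, hj⟩
  exact ⟨n, hn, hj.trans h⟩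

/-- The open subsets of `X` that contain `F_j X`. -/
abbrev OpensContaining (j : ℤ) : Type u := {U : Opens X // F X j ⊆ U}

/-- The inclusion of the open subsets containing `F_j X` into all open subsets. -/
abbrev OpensContaining.incl (j : ℤ) : OpensContaining X j ⥤ Opens X :=
  Monotone.functor (f := Subtype.val) (fun _ _ h ↦ h)

/-- An open subset which contains `F_{j'} X` contains `F_j X` if `j ≤ j'`. -/
abbrev OpensContaining.ofLE {j j' : ℤ} (h : j ≤ j') : OpensContaining X j' ⥤ OpensContaining X j :=
  Monotone.functor (f := fun U ↦ ⟨U.1, (F_mono X h).trans U.2⟩) (fun _ _ h ↦ h)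

variable {X}

/-- The value `colim_{U ⊇ F_j X} P(U)` on `F_j X` of a presheaf `P` on `X`. -/
noncomputable def onF (P : (Opens X)ᵒᵖ ⥤ AddCommGrpCat.{u}) (j : ℤ) : AddCommGrpCat.{u} :=
  colimit ((OpensContaining.incl X j).op ⋙ P)

/-- The restriction map from `F_{j'} X` to `F_j X` if `j ≤ j'`. -/
noncomputable def onF.restrict (P : (Opens X)ᵒᵖ ⥤ AddCommGrpCat.{u}) {j j' : ℤ} (h : j ≤ j') :
    onF P j' ⟶ onF P j :=
  colimit.pre ((OpensContaining.incl X j).op ⋙ P) (OpensContaining.ofLE X h).op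

/-- The restriction map from `X` to `F_j X`. -/
noncomputable def onF.ofTop (P : (Opens X)ᵒᵖ ⥤ AddCommGrpCat.{u}) (j : ℤ) :
    P.obj (op ⊤) ⟶ onF P j :=
  colimit.ι ((OpensContaining.incl X j).op ⋙ P) (op ⟨⊤, fun _ _ ↦ trivial⟩)

/-- The map on `F_j X` induced by a morphism of presheaves. -/
noncomputable def onF.map {P P' : (Opens X)ᵒᵖ ⥤ AddCommGrpCat.{u}} (φ : P ⟶ P') (j : ℤ) :
    onF P j ⟶ onF P' j :=
  colimMap (Functor.whiskerLeft _ φ)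

end Codimension

section Gersten

variable {X : Scheme.{u}}

/-- The Zariski site of `X`. -/
abbrev zar (X : Scheme.{u}) : GrothendieckTopology (Opens X) := Opens.grothendieckTopology X

open scoped Classical in
/-- The sheaf `ι_{x*} A` on `X`: its sections over `U` are `A` if `x ∈ U`, i.e. if `U` meets
`closure {x}`, and `0` otherwise. As `closure {x}` is irreducible, this is the constant sheaf
with value `A` on `closure {x}`, extended by zero to `X`. -/
noncomputable def pointSheaf (x : X) (A : AddCommGrpCat.{u}) : AbSheaf (zar X) :=
  skyscraperSheaf (X := X.toTopCat) x A

/-- A resolution of a Zariski sheaf `ℱ` by a complex whose term in degree `p` is the direct sum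
of the sheaves `ι_{x*} (A p x)`, where `x` runs through the points of codimension `p`. -/
structure GerstenResolution (ℱ : AbSheaf (zar X)) (A : ℕ → X → AddCommGrpCat.{u}) where
  /-- the complex -/
  E : CochainComplex (AbSheaf (zar X)) ℕ
  /-- the description of its terms -/
  iso (p : ℕ) : E.X p ≅ ∐ fun x : {x : X // codim x = p} ↦ pointSheaf x.1 (A p x.1)
  /-- the augmentation -/
  ε : (CochainComplex.single₀ (AbSheaf (zar X))).obj ℱ ⟶ E
  /-- the augmentation is a quasi-isomorphism -/
  quasiIso : QuasiIso ε

end Gersten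

section Main

variable {X : Scheme.{u}} {C : Type u} [SmallCategory C] {J : GrothendieckTopology C}
  (v : Opens X ⥤ C)

instance sheafPushforwardContinuous_additive [v.IsContinuous (zar X) J] :
    (v.sheafPushforwardContinuous AddCommGrpCat.{u} (zar X) J).Additive where
  map_add := rfl

/-- The total direct image `Rπ_* K` for the morphism of sites `π : (C, J) ⟶ X_Zar` given by the
functor `v : U ↦ π⁻¹(U)`. -/
noncomputable def totalDirectImage [v.IsContinuous (zar X) J] (K : CochainComplex (AbSheaf J) ℤ) :
    CochainComplex (AbSheaf (zar X)) ℤ :=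
  ((v.sheafPushforwardContinuous AddCommGrpCat.{u} (zar X) J).mapHomologicalComplex _).obj
    (injRepl K)

/-- The presheaf `U ↦ Hⁱ(U_ν, K)` on `X`, where `U_ν` stands for the object `v U` of the site. -/
noncomputable def hypercohomologyOnOpens (K : CochainComplex (AbSheaf J) ℤ) (i : ℤ) :
    (Opens X)ᵒᵖ ⥤ AddCommGrpCat.{u} :=
  v.op ⋙ hypercohomology K i

/-- The refined unramified cohomology
`Hⁱ_{j,nr}(X_ν, K) = im (Hⁱ(F_{j+1} X, K) ⟶ Hⁱ(F_j X, K))`. -/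
noncomputable def refinedUnramified (K : CochainComplex (AbSheaf J) ℤ) (i j : ℤ) :
    AddSubgroup (onF (hypercohomologyOnOpens v K i) j) :=
  (onF.restrict (hypercohomologyOnOpens v K i) (j := j) (j' := j + 1) (by lia)).hom.range

/-- The natural map `Hⁱ(U_ν, K) ⟶ Hⁱ(U_Zar, τ_{≥ s} Rπ_* K)`. It is induced by the morphisms
of complexes `Rπ_* K ⟶ τ_{≥ s} Rπ_* K ⟶ I`, where `I` is the K-injective replacement of
`τ_{≥ s} Rπ_* K`, and by the equality `Γ(U_ν, -) = Γ(U, π_* -)`. -/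
noncomputable def toTruncation [v.IsContinuous (zar X) J] (K : CochainComplex (AbSheaf J) ℤ)
    (i s : ℤ) :
    hypercohomologyOnOpens v K i ⟶ hypercohomology ((totalDirectImage v K).truncGE s) i :=
  sectionsCohomologyMap
    ((totalDirectImage v K).πTruncGE s ≫ toInjRepl ((totalDirectImage v K).truncGE s)) i

end Main

end RefinedUnramified

/-! Write L for Rπ_*K, T for the K-injective replacement of τ_{≥s} L, P(U) = H^i(Γ(U, L)) = H^i(U_ν,
K), Q(U) = H^i(Γ(U, T)) and j = i - s. Both P(F_j X) and Q(X) embed into Q(F_j X), and the refined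
unramified part of P(F_j X) has the same image there as Q(X); this gives φ and its uniqueness. By
`existsUnique_equiv_range_restrict` four facts suffice: P → Q is surjective on F_{j+1} X and
injective on F_j X, and the restriction Q(X) → Q(U) is surjective if U contains F_{j+1} X and
injective if U contains F_j X.

The first two facts use no Gersten resolutions. The cone of L → T is exact in degrees ≥ s - 1,
because T keeps exactly the cohomology of L in degrees ≥ s. A cocycle of degree i in a termwise
flasque complex that is exact in the j degrees up to i becomes a coboundary near all points of
codimension < j (`exists_isCoboundary_restrict`). Indeed a primitive exists locally; two local
primitives differ by a cocycle of degree i - 1, which by induction is a coboundary off a closed set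
whose points all have codimension at least j - 1; a further point of codimension j - 1 avoids the
closure of this set, so the primitives can be glued there. On a finite-dimensional Noetherian space
this also shows that unbounded termwise flasque complexes compute cohomology
(`isCoboundary_of_exactAt_le`).

The last two facts come from the Gersten resolutions (`restrictionBijective_of_gersten`). A Gersten
complex starting in degree q involves in degrees ≤ m + q only points of codimension ≤ m; these lie
in every U that contains F_m X, so its sections over X and over U agree in this range. In general
the lowest cohomology sheaf is split off: its Gersten complex maps to the given complex, the cone
starts one degree later, and a four lemma combines the two. Finitely many steps suffice, since
complexes exact up to degree a have no cohomology there.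

Cohomology classes are handled as cocycles modulo coboundaries in groups of sections. Flasqueness is
obtained from K-injective complexes with injective terms, to which the chosen replacements are
homotopy equivalent. -/

namespace RefinedUnramified

open CategoryTheory Limits TopologicalSpace Opposite AlgebraicGeometry

/-! ### Sections of Zariski sheaves -/

section Sections

variable {X : Scheme.{u}}

/-- The group of sections of an abelian sheaf over an open subset. -/
abbrev sec (G : AbSheaf (zar X)) (U : Opens X) : Type u := G.obj.obj (op U)

/-- The restriction of sections. -/
noncomputable def res (G : AbSheaf (zar X)) {U V : Opens X} (h : V ≤ U) : sec G U →+ sec G V :=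
  (G.obj.map (homOfLE h).op).hom

/-- The map on sections induced by a morphism of sheaves. -/
noncomputable def onSec {G H : AbSheaf (zar X)} (φ : G ⟶ H) (U : Opens X) : sec G U →+ sec H U :=
  (φ.hom.app (op U)).hom

variable {G H K : AbSheaf (zar X)} {U V W : Opens X}

@[simp]
lemma res_self (a : sec G U) : res G le_rfl a = a :=
  ConcreteCategory.congr_hom (G.obj.map_id (op U)) a

@[simp]
lemma res_res (h : V ≤ U) (h' : W ≤ V) (a : sec G U) :
    res G h' (res G h a) = res G (h'.trans h) a :=
  (ConcreteCategory.congr_hom (G.obj.map_comp (homOfLE h).op (homOfLE h').op) a).symm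

@[simp]
lemma onSec_res (φ : G ⟶ H) (h : V ≤ U) (a : sec G U) :
    onSec φ V (res G h a) = res H h (onSec φ U a) :=
  ConcreteCategory.congr_hom (φ.hom.naturality (homOfLE h).op) a

@[simp]
lemma onSec_comp (φ : G ⟶ H) (ψ : H ⟶ K) (a : sec G U) :
    onSec (φ ≫ ψ) U a = onSec ψ U (onSec φ U a) := rfl

@[simp]
lemma onSec_id (a : sec G U) : onSec (𝟙 G) U a = a := rfl

@[simp]
lemma onSec_zero (a : sec G U) : onSec (0 : G ⟶ H) U a = 0 := rfl

@[simp]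
lemma onSec_add (φ ψ : G ⟶ H) (a : sec G U) : onSec (φ + ψ) U a = onSec φ U a + onSec ψ U a := rfl

@[simp]
lemma onSec_neg (φ : G ⟶ H) (a : sec G U) : onSec (-φ) U a = -onSec φ U a := rfl

lemma sec_ext_of_locally {a b : sec G U}
    (h : ∀ x ∈ U, ∃ (V : Opens X) (hV : V ≤ U), x ∈ V ∧ res G hV a = res G hV b) : a = b := by
  choose! V hV hx hab using h
  refine TopCat.Sheaf.eq_of_locally_eq' (X := X.toTopCat) G (fun x : U ↦ V x.1) U
    (fun x ↦ homOfLE (hV x.1 x.2)) (fun x hx' ↦ ?_) a b (fun x ↦ hab x.1 x.2)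
  exact Opens.mem_iSup.2 ⟨⟨x, hx'⟩, hx x hx'⟩

lemma exists_glue (a : sec G V) (b : sec G W)
    (h : res G (inf_le_left : V ⊓ W ≤ V) a = res G inf_le_right b) :
    ∃ c : sec G (V ⊔ W), res G le_sup_left c = a ∧ res G le_sup_right c = b := by
  obtain ⟨c, h1, -⟩ := TopCat.Sheaf.existsUnique_gluing' (X := X.toTopCat) G
    -- `Bool.rec` takes the value at `false` first: `true` indexes V and `false` indexes W.
    (fun t : ULift.{u} Bool ↦ Bool.rec W V t.down) (V ⊔ W)
    (fun t ↦ match t with | ⟨true⟩ => homOfLE le_sup_left | ⟨false⟩ => homOfLE le_sup_right)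
    (sup_le (le_iSup (fun t : ULift.{u} Bool ↦ (Bool.rec W V t.down : Opens X)) ⟨true⟩)
      (le_iSup (fun t : ULift.{u} Bool ↦ (Bool.rec W V t.down : Opens X)) ⟨false⟩))
    (fun t ↦ match t with | ⟨true⟩ => a | ⟨false⟩ => b)
    (by
      rintro ⟨_ | _⟩ ⟨_ | _⟩
      · rfl
      · have := congr_arg (res G (show W ⊓ V ≤ V ⊓ W from le_of_eq (inf_comm W V))) h
        simp only [res_res] at this
        exact this.symm
      · exact h
      · rfl)
  exact ⟨c, h1 ⟨true⟩, h1 ⟨false⟩⟩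

lemma eq_of_bot (a b : sec G (⊥ : Opens X)) : a = b :=
  sec_ext_of_locally fun _ hx ↦ hx.elim

variable (G) in
/-- A sheaf is flasque if all its sections extend. -/
def Flasque : Prop := ∀ ⦃U V : Opens X⦄ (h : V ≤ U), Function.Surjective (res G h)

lemma exists_local_preimage (φ : G ⟶ H) [hφ : Epi φ] (a : sec H U) {x : X} (hx : x ∈ U) :
    ∃ (V : Opens X) (hV : V ≤ U) (b : sec G V), x ∈ V ∧ onSec φ V b = res H hV a := by
  obtain ⟨V, hV, ⟨b, hb⟩, hxV⟩ := (TopCat.Presheaf.isLocallySurjective_iff (X := X.toTopCat) _).1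
    ((TopCat.Sheaf.isLocallySurjective_iff_epi (X := X.toTopCat) φ).2 hφ) U a x hx
  exact ⟨V, hV, b, hxV, hb⟩

/-- Taking sections is left exact. -/
lemma exists_preimage_of_exact {S : ShortComplex (AbSheaf (zar X))} (hS : S.Exact) [hf : Mono S.f]
    (a : sec S.X₂ U) (ha : onSec S.g U a = 0) : ∃ b : sec S.X₁ U, onSec S.f U b = a :=
  TopCat.Sheaf.sections_exact_of_left_exact (X := X.toTopCat) hS hf a ha

end Sections

/-! ### Cocycles and coboundaries in complexes of sheaves -/

section Complexes

variable {X : Scheme.{u}} (M : CochainComplex (AbSheaf (zar X)) ℤ)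

/-- The sections of a complex over `U` that are cocycles. -/
def IsCocycle {n : ℤ} {U : Opens X} (a : sec (M.X n) U) : Prop :=
  onSec (M.d n (n + 1)) U a = 0

/-- The sections of a complex over `U` that are coboundaries over `U`. -/
def IsCoboundary {n : ℤ} {U : Opens X} (a : sec (M.X n) U) : Prop :=
  ∃ b : sec (M.X (n - 1)) U, onSec (M.d (n - 1) n) U b = a

variable {M} {n : ℤ} {U V : Opens X}

/-- Keeping the degree k as a variable avoids transport between the degrees n and n - 1 + 1. -/
lemma isCoboundary_iff {k : ℤ} (hk : k + 1 = n) {a : sec (M.X n) U} :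
    IsCoboundary M a ↔ ∃ b : sec (M.X k) U, onSec (M.d k n) U b = a := by
  obtain rfl : k = n - 1 := by lia
  rfl

lemma isCocycle_iff {k : ℤ} (hk : n + 1 = k) {a : sec (M.X n) U} :
    IsCocycle M a ↔ onSec (M.d n k) U a = 0 := by
  subst hk
  rfl

@[simp]
lemma onSec_d_d {i j k : ℤ} (a : sec (M.X i) U) : onSec (M.d j k) U (onSec (M.d i j) U a) = 0 := by
  rw [← onSec_comp, M.d_comp_d]
  rfl

lemma onSec_f_d {N : CochainComplex (AbSheaf (zar X)) ℤ} (φ : M ⟶ N) {i j : ℤ}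
    (a : sec (M.X i) U) :
    onSec (φ.f j) U (onSec (M.d i j) U a) = onSec (N.d i j) U (onSec (φ.f i) U a) := by
  rw [← onSec_comp, ← φ.comm, onSec_comp]

lemma IsCocycle.restrict {a : sec (M.X n) U} (ha : IsCocycle M a) (h : V ≤ U) :
    IsCocycle M (res _ h a) := by
  rw [IsCocycle, onSec_res, ha, map_zero]

lemma IsCoboundary.restrict {a : sec (M.X n) U} (ha : IsCoboundary M a) (h : V ≤ U) :
    IsCoboundary M (res _ h a) := by
  obtain ⟨b, rfl⟩ := ha
  exact ⟨res _ h b, onSec_res _ _ _⟩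

lemma IsCocycle.sub {a b : sec (M.X n) U} (ha : IsCocycle M a) (hb : IsCocycle M b) :
    IsCocycle M (a - b) := by
  rw [IsCocycle, map_sub, ha, hb, sub_zero]

lemma IsCoboundary.add {a b : sec (M.X n) U} (ha : IsCoboundary M a) (hb : IsCoboundary M b) :
    IsCoboundary M (a + b) := by
  obtain ⟨a, rfl⟩ := ha
  obtain ⟨b, rfl⟩ := hb
  exact ⟨a + b, map_add _ _ _⟩

lemma IsCoboundary.sub {a b : sec (M.X n) U} (ha : IsCoboundary M a) (hb : IsCoboundary M b) :
    IsCoboundary M (a - b) := by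
  obtain ⟨a, rfl⟩ := ha
  obtain ⟨b, rfl⟩ := hb
  exact ⟨a - b, map_sub _ _ _⟩

lemma isCoboundary_zero : IsCoboundary M (0 : sec (M.X n) U) := ⟨0, map_zero _⟩

lemma IsCocycle.map {N : CochainComplex (AbSheaf (zar X)) ℤ} (φ : M ⟶ N) {a : sec (M.X n) U}
    (ha : IsCocycle M a) : IsCocycle N (onSec (φ.f n) U a) := by
  rw [IsCocycle, ← onSec_f_d, ha, map_zero]

lemma IsCoboundary.map {N : CochainComplex (AbSheaf (zar X)) ℤ} (φ : M ⟶ N) {a : sec (M.X n) U}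
    (ha : IsCoboundary M a) : IsCoboundary N (onSec (φ.f n) U a) := by
  obtain ⟨b, rfl⟩ := ha
  exact ⟨onSec (φ.f _) U b, (onSec_f_d φ b).symm⟩

/-- In an exact degree, cocycles are locally coboundaries. -/
lemma IsCocycle.exists_isCoboundary {a : sec (M.X n) U} (ha : IsCocycle M a) (hM : M.ExactAt n)
    {x : X} (hx : x ∈ U) :
    ∃ (V : Opens X) (hV : V ≤ U), x ∈ V ∧ IsCoboundary M (res _ hV a) := by
  have hM' := (M.exactAt_iff' (n - 1) n (n + 1) (by simp) (by simp)).1 hM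
  -- A cocycle is a section of the kernel sheaf; exactness makes the differential an epimorphism
  -- onto it, so that the section lifts locally.
  have := hM'.epi_toCycles
  have hS := ShortComplex.exact_of_f_is_kernel
    (ShortComplex.mk _ _ (M.sc' (n - 1) n (n + 1)).iCycles_g)
    (M.sc' (n - 1) n (n + 1)).cyclesIsKernel
  obtain ⟨c, hc⟩ := exists_preimage_of_exact
    (S := ShortComplex.mk _ _ (M.sc' (n - 1) n (n + 1)).iCycles_g) hS a ha
  obtain ⟨V, hV, b, hxV, hb⟩ :=
    exists_local_preimage (M.sc' (n - 1) n (n + 1)).toCycles c hx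
  refine ⟨V, hV, hxV, b, ?_⟩
  have h := congr_arg (onSec (M.sc' (n - 1) n (n + 1)).iCycles V) hb
  rw [← onSec_comp, onSec_res, ShortComplex.toCycles_i] at h
  exact h.trans (congr_arg (res _ hV) hc)

variable (M) in
/-- A complex of sheaves is termwise flasque if all its terms are flasque. -/
def TermwiseFlasque : Prop := ∀ n, Flasque (M.X n)

end Complexes

end RefinedUnramified

namespace RefinedUnramified

open CategoryTheory Limits TopologicalSpace Opposite AlgebraicGeometry

/-! ### Codimension and specialization -/

section Codimension

/-- The irreducible closed subsets of closure {y} embed strictly monotonically into those of closure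
{x}, and closure {x} itself lies strictly above all of them because x is not in closure {y}.
Adjoining this top element accounts for the + 1. -/
lemma krullDim_closure_lt {T : Type*} [TopologicalSpace T] [T0Space T] {x y : T} (h : x ⤳ y)
    (hne : x ≠ y) :
    topologicalKrullDim (closure {y} : Set T) + 1 ≤ topologicalKrullDim (closure {x} : Set T) := by
  have hle : closure {y} ⊆ closure {x} := h.closure_subset
  have hi : Topology.IsInducing (Set.inclusion hle) := (Topology.IsEmbedding.inclusion hle).isInducing
  let f := IrreducibleCloseds.map (Set.inclusion hle) hi.continuous
  have hf : StrictMono f := IrreducibleCloseds.map_strictMono_of_isInducing hi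
  have hirr : IsIrreducible (Set.univ : Set (closure {x} : Set T)) := by
    have : IrreducibleSpace (closure {x} : Set T) :=
      isIrreducible_iff_irreducibleSpace.1 isIrreducible_singleton.closure
    exact (irreducibleSpace_def _).1 this
  let t : IrreducibleCloseds (closure {x} : Set T) := ⟨Set.univ, hirr, isClosed_univ⟩
  have hyc : IsClosed ((↑) ⁻¹' (closure {y}) : Set (closure {x} : Set T)) :=
    isClosed_closure.preimage continuous_subtype_val
  have ht (a) : f a < t := by
    refine lt_of_le_of_ne (fun _ _ ↦ trivial) fun h0 ↦ hne ?_
    have h1 : (f a : Set (closure {x} : Set T)) ⊆ (↑) ⁻¹' (closure {y}) := by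
      refine closure_minimal ?_ hyc
      rintro _ ⟨b, -, rfl⟩
      exact b.2
    rw [h0] at h1
    have h2 : x ∈ closure {y} := h1 (show (⟨x, subset_closure rfl⟩ : (closure {x} : Set T)) ∈ _ from
      trivial)
    exact (h.antisymm (specializes_iff_mem_closure.2 h2)).eq
  let g : WithTop (IrreducibleCloseds (closure {y} : Set T)) →
      IrreducibleCloseds (closure {x} : Set T) := fun a ↦ WithTop.recTopCoe t f a
  have hg : StrictMono g := by
    intro a b hab
    induction a using WithTop.recTopCoe with
    | top => exact (not_top_lt hab).elim
    | coe a =>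
      induction b using WithTop.recTopCoe with
      | top => exact ht a
      | coe b => exact hf (WithTop.coe_lt_coe.1 hab)
  have : Nonempty (IrreducibleCloseds (closure {y} : Set T)) :=
    ⟨⟨closure {⟨y, subset_closure rfl⟩}, isIrreducible_singleton.closure, isClosed_closure⟩⟩
  have h3 := Order.krullDim_le_of_strictMono g hg
  rwa [Order.krullDim_WithTop] at h3

variable {X : Scheme.{u}}

/-- Finite dimension is what makes the truncated subtraction in `ℕ∞` reverse the strict inequality
of dimensions. -/
lemma codim_lt_codim (hd : topologicalKrullDim X ≠ ⊤) {x y : X} (h : x ⤳ y) (hne : x ≠ y) :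
    codim x < codim y := by
  have h1 := krullDim_closure_lt h hne
  have h2 := topologicalKrullDim_subspace_le X (closure {x})
  have hne (z : X) : topologicalKrullDim (closure {z} : Set X) ≠ ⊥ := by
    have : Nonempty (IrreducibleCloseds (closure {z} : Set X)) :=
      ⟨⟨closure {⟨z, subset_closure rfl⟩}, isIrreducible_singleton.closure, isClosed_closure⟩⟩
    exact Order.krullDim_ne_bot_iff.2 this
  have hx := hne x
  have hy := hne y
  rw [codim, codim]
  generalize topologicalKrullDim X = d at *
  generalize topologicalKrullDim (closure {x} : Set X) = a at *
  generalize topologicalKrullDim (closure {y} : Set X) = b at *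
  cases a with
  | bot => exact (hx rfl).elim
  | coe a =>
  cases b with
  | bot => exact (hy rfl).elim
  | coe b =>
  cases d with
  | bot => simp at h2
  | coe d =>
  simp only [WithBot.unbotD_coe]
  have h1' : b + 1 ≤ a := by exact_mod_cast h1
  have h2' : a ≤ d := by exact_mod_cast h2
  have hd' : d ≠ ⊤ := fun h ↦ hd (by rw [h]; rfl)
  lift d to ℕ using hd'
  have ha : a ≠ ⊤ := ne_top_of_le_ne_top (ENat.natCast_ne_top d) h2'
  lift a to ℕ using ha
  have hb : b ≠ ⊤ := ne_top_of_le_ne_top (ENat.natCast_ne_top a) (le_self_add.trans h1')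
  lift b to ℕ using hb
  norm_cast at *
  lia

lemma exists_F_eq_univ (hd : topologicalKrullDim X ≠ ⊤) : ∃ d : ℕ, F X d = Set.univ := by
  have h : (topologicalKrullDim X).unbotD 0 ≠ ⊤ := by
    generalize topologicalKrullDim X = d at *
    cases d with
    | bot => simp
    | coe d => exact fun h ↦ hd (by rw [show d = ⊤ from h]; rfl)
  obtain ⟨d, hd'⟩ := ENat.ne_top_iff_exists.1 h
  refine ⟨d, Set.eq_univ_of_forall fun x ↦ ?_⟩
  have hx : codim x ≤ d := by rw [codim, ← hd']; exact tsub_le_self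
  obtain ⟨n, hn⟩ := ENat.ne_top_iff_exists.1 (ne_top_of_le_ne_top (ENat.natCast_ne_top d) hx)
  exact ⟨n, hn.symm, by rw [← hn] at hx; exact_mod_cast hx⟩

lemma not_mem_F_of_neg {j : ℤ} (hj : j < 0) (x : X) : x ∉ F X j := by
  rintro ⟨n, -, h⟩
  lia

/-- A point in the closure of a locally closed subset of a Noetherian sober space is a
specialization of one of its points. -/
lemma exists_specializes_of_mem_closure_diff {T : Type*} [TopologicalSpace T] [NoetherianSpace T]
    [QuasiSober T] {O V : Set T} (hO : IsOpen O) (hV : IsOpen V) {x : T}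
    (hx : x ∈ closure (O \ V)) : ∃ y ∈ O \ V, y ⤳ x := by
  -- The closure of O \ V is a finite union of irreducible closed sets Z. The point x lies in the
  -- closure of Z ∩ (O \ V) for one of them, and the generic point η of this Z is the point sought:
  -- O meets Z, hence contains η, while η ∈ V would force V to meet O \ V.
  obtain ⟨S, hS, hSc, hSi, hSU⟩ := NoetherianSpace.exists_finite_set_isClosed_irreducible
    (isClosed_closure (s := O \ V))
  have h1 : O \ V ⊆ ⋃ Z ∈ S, closure (Z ∩ (O \ V)) := fun y hy ↦ by
    obtain ⟨Z, hZ, hyZ⟩ := hSU ▸ subset_closure hy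
    exact Set.mem_biUnion hZ (subset_closure ⟨hyZ, hy⟩)
  have h2 := closure_minimal h1 (hS.isClosed_biUnion fun Z _ ↦ isClosed_closure) hx
  obtain ⟨Z, hZ, hxZ⟩ := Set.mem_iUnion₂.1 h2
  obtain ⟨y, hyZ, hyO, -⟩ : (Z ∩ (O \ V)).Nonempty := closure_nonempty_iff.1 ⟨x, hxZ⟩
  obtain ⟨η, hη⟩ := QuasiSober.sober (hSi Z hZ) (hSc Z hZ)
  refine ⟨η, ⟨(hη.mem_open_set_iff hO).2 ⟨y, hyZ, hyO⟩, fun hηV ↦ ?_⟩,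
    hη.specializes (closure_minimal Set.inter_subset_left (hSc Z hZ) hxZ)⟩
  have h3 : η ∈ closure (O \ V) := hSU ▸ ⟨Z, hZ, hη.mem⟩
  obtain ⟨z, hzV, -, hzV'⟩ := mem_closure_iff.1 h3 V hV hηV
  exact hzV' hzV

end Codimension

end RefinedUnramified

namespace RefinedUnramified

open CategoryTheory Limits TopologicalSpace Opposite AlgebraicGeometry

/-! ### Vanishing of cohomology near points of small codimension -/

section Vanishing

variable {X : Scheme.{u}} {M : CochainComplex (AbSheaf (zar X)) ℤ}

/-- If the difference of two primitives of `a`, over `V` and over `W`, is a coboundary on the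
intersection, then `a` is a coboundary on the union. -/
lemma isCoboundary_sup (hM : TermwiseFlasque M) {i k : ℤ} (hk : k + 1 = i) {U V W : Opens X}
    (hV : V ≤ U) (hW : W ≤ U) {a : sec (M.X i) U} {b : sec (M.X k) V} {c : sec (M.X k) W}
    (hb : onSec (M.d k i) V b = res _ hV a) (hc : onSec (M.d k i) W c = res _ hW a)
    (hbc : IsCoboundary M (res _ (inf_le_left : V ⊓ W ≤ V) b - res _ inf_le_right c)) :
    IsCoboundary M (res _ (sup_le hV hW) a) := by
  obtain ⟨e, he⟩ := hbc
  -- By flasqueness e extends to V. Then b - de is still a primitive of a on V, and it agrees with c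
  -- on the intersection.
  obtain ⟨e, rfl⟩ := hM _ inf_le_left e
  obtain ⟨g, hg₁, hg₂⟩ := exists_glue (b - onSec (M.d _ _) V e) c (by
    rw [map_sub, ← onSec_res, he]
    abel)
  refine (isCoboundary_iff hk).2 ⟨g, sec_ext_of_locally fun x hx ↦ ?_⟩
  rcases hx with hx | hx
  · refine ⟨V, le_sup_left, hx, ?_⟩
    rw [← onSec_res, hg₁, map_sub, onSec_d_d, sub_zero, hb, res_res]
  · refine ⟨W, le_sup_right, hx, ?_⟩
    rw [← onSec_res, hg₂, hc, res_res]

/-- A cocycle of degree `i` of a termwise flasque complex that is exact in the degrees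
`i - j + 1, …, i` is a coboundary on an open subset that contains all points of codimension at
most `j - 1`. -/
theorem exists_isCoboundary_restrict [NoetherianSpace X] (hd : topologicalKrullDim X ≠ ⊤)
    (hM : TermwiseFlasque M) (j : ℕ) (i : ℤ) (hi : ∀ q, i - j < q → q ≤ i → M.ExactAt q)
    (U : Opens X) (a : sec (M.X i) U) (ha : IsCocycle M a) :
    ∃ (V : Opens X) (hV : V ≤ U), (∀ x ∈ U, x ∈ F X (j - 1) → x ∈ V) ∧
      IsCoboundary M (res _ hV a) := by
  induction j generalizing i U with
  | zero =>
    -- The empty open set suffices, as there are no points of negative codimension.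
    refine ⟨⊥, bot_le, fun x _ hx ↦ (not_mem_F_of_neg (by simp) x hx).elim, 0, eq_of_bot _ _⟩
  | succ j ih =>
    let S : Set (Opens X) := {V | ∃ hV : V ≤ U, (∀ x ∈ U, x ∈ F X (j - 1) → x ∈ V) ∧
      IsCoboundary M (res _ hV a)}
    have hS : S.Nonempty := by
      obtain ⟨V, hV⟩ := ih i (fun q hq hq' ↦ hi q (by lia) hq') U a ha
      exact ⟨V, hV⟩
    -- Noetherianity provides a maximal V on which a is a coboundary. A missing point of codimension
    -- j allows V to be enlarged.
    obtain ⟨V, ⟨hV, hFV, hb⟩, hmax⟩ := WellFounded.has_min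
      (wellFounded_gt : WellFounded ((· > ·) : Opens X → Opens X → Prop)) S hS
    refine ⟨V, hV, fun x hxU hx ↦ ?_, hb⟩
    by_contra hxV
    obtain ⟨n, hn, hnj⟩ := hx
    have hnj' : n = j := by
      by_contra h
      exact hxV (hFV x hxU ⟨n, hn, by push_cast at hnj; lia⟩)
    subst hnj'
    obtain ⟨W, hW, hxW, hc⟩ := ha.exists_isCoboundary (hi i (by lia) le_rfl) hxU
    have hk : i - 1 + 1 = i := by lia
    obtain ⟨b, hb⟩ := (isCoboundary_iff hk).1 hb
    obtain ⟨c, hc⟩ := (isCoboundary_iff hk).1 hc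
    have hbc : IsCocycle M (res _ (inf_le_left : V ⊓ W ≤ V) b - res _ inf_le_right c) := by
      rw [isCocycle_iff hk, map_sub, onSec_res, onSec_res, hb, hc, res_res, res_res, sub_self]
    -- The difference of the primitives has degree i - 1, and the exactness range required for j in
    -- that degree is part of the given one.
    obtain ⟨V', hV', hFV', hV'b⟩ := ih (i - 1)
      (fun q hq hq' ↦ hi q (by push_cast; lia) (by lia)) (V ⊓ W) _ hbc
    -- W' is W without the closure of the locus where the primitives may differ by more than a
    -- coboundary. It still contains x: a point y of this locus specializing to x differs from x ∉
    -- V, so it has smaller codimension and would lie in V'.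
    let W' : Opens X := W ⊓ ⟨(closure ((V ⊓ W : Opens X) \ V' : Set X))ᶜ, isClosed_closure.isOpen_compl⟩
    have hW'W : W' ≤ W := inf_le_left
    have hxW' : x ∈ W' := by
      refine ⟨hxW, fun hx ↦ ?_⟩
      obtain ⟨y, ⟨hy, hyV'⟩, hyx⟩ :=
        exists_specializes_of_mem_closure_diff (V ⊓ W).isOpen V'.isOpen hx
      have hlt := codim_lt_codim hd hyx (by rintro rfl; exact hxV hy.1)
      obtain ⟨m, hm⟩ := ENat.ne_top_iff_exists.1 hlt.ne_top
      refine hyV' (hFV' y hy ⟨m, hm.symm, ?_⟩)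
      rw [← hm, hn] at hlt
      have : m < n := by exact_mod_cast hlt
      lia
    have hVW' : V ⊓ W' ≤ V' := by
      intro y hy
      by_contra hyV'
      exact hy.2.2 (subset_closure ⟨⟨hy.1, hy.2.1⟩, hyV'⟩)
    have hsup := isCoboundary_sup hM hk hV (hW'W.trans hW) (a := a) (b := b) (c := res _ hW'W c) hb
      (by rw [onSec_res, hc, res_res]) (by simpa using hV'b.restrict hVW')
    refine hmax (V ⊔ W') ⟨_, fun y hy hy' ↦ Or.inl (hFV y hy hy'), hsup⟩
      (lt_of_le_of_ne le_sup_left fun h ↦ hxV ?_)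
    rw [h]
    exact Or.inr hxW'

/-- In degrees below which a termwise flasque complex is exact, its sections are exact. -/
theorem isCoboundary_of_exactAt_le [NoetherianSpace X] (hd : topologicalKrullDim X ≠ ⊤)
    (hM : TermwiseFlasque M) {i : ℤ} (hi : ∀ q ≤ i, M.ExactAt q) {U : Opens X}
    {a : sec (M.X i) U} (ha : IsCocycle M a) : IsCoboundary M a := by
  obtain ⟨d, hd'⟩ := exists_F_eq_univ hd
  -- With d + 1 in place of j the set V contains all points of U in F_d X, hence all of U.
  obtain ⟨V, hV, hF, h⟩ := exists_isCoboundary_restrict hd hM (d + 1) i (fun q _ hq ↦ hi q hq) U a ha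
  obtain rfl : V = U := le_antisymm hV fun x hx ↦ hF x hx (by
    rw [Nat.cast_add, Nat.cast_one, add_sub_cancel_right, hd']
    trivial)
  simpa using h

end Vanishing

end RefinedUnramified

/-! ### The long exact sequence of a mapping cone -/

namespace CochainComplex.mappingCone

open CategoryTheory Limits HomologicalComplex

variable {A : Type u} [Category.{v} A] [Abelian A] {L T : CochainComplex A ℤ} (φ : L ⟶ T)

/-- A generalized element of the cone in degree q is a pair (l, t) with l in degree q + 1 of L, and
its differential is (-dl, φ(l) + dt). -/
lemma comp_d_eq_zero_iff {Z : A} (q : ℤ) (l : Z ⟶ L.X (q + 1)) (t : Z ⟶ T.X q) :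
    (l ≫ (inl φ).v (q + 1) q (by lia) + t ≫ (inr φ).f q) ≫ (mappingCone φ).d q (q + 1) = 0 ↔
      l ≫ L.d (q + 1) (q + 2) = 0 ∧ l ≫ φ.f (q + 1) + t ≫ T.d q (q + 1) = 0 := by
  rw [ext_to_iff φ (q + 1) (q + 2) (by lia)]
  simp [d_fst_v φ q (q + 1) (q + 2) rfl (by lia), d_snd_v φ q (q + 1) rfl]

lemma eq_comp_d_iff {Z : A} (q : ℤ) (l : Z ⟶ L.X (q + 1)) (t : Z ⟶ T.X q)
    (l' : Z ⟶ L.X q) (t' : Z ⟶ T.X (q - 1)) :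
    l ≫ (inl φ).v (q + 1) q (by lia) + t ≫ (inr φ).f q =
        (l' ≫ (inl φ).v q (q - 1) (by lia) + t' ≫ (inr φ).f (q - 1)) ≫
          (mappingCone φ).d (q - 1) q ↔
      l = -l' ≫ L.d q (q + 1) ∧ t = l' ≫ φ.f q + t' ≫ T.d (q - 1) q := by
  rw [ext_to_iff φ q (q + 1) rfl]
  simp [d_fst_v φ (q - 1) q (q + 1) (by lia) rfl, d_snd_v φ (q - 1) q (by lia)]

/-- Let (l, t) be a cocycle of the cone. Then φ(l) is a coboundary, so by injectivity on H^{q+1} l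
is one after refinement; what remains is a cocycle of T, which surjectivity on H^q brings from L up
to a coboundary. -/
lemma exactAt_of_epi_of_mono (q : ℤ) (he : Epi (homologyMap φ q))
    (hm : Mono (homologyMap φ (q + 1))) : (mappingCone φ).ExactAt q := by
  rw [exactAt_iff_exact_up_to_refinements _ (q - 1) q (q + 1) (by simp) (by simp)]
  intro Z z hz
  obtain ⟨l, t, rfl⟩ := decomp_to φ z (q + 1) rfl
  obtain ⟨h1, h2⟩ := (comp_d_eq_zero_iff φ q l t).1 hz
  rw [mono_homologyMap_iff_up_to_refinements φ q (q + 1) (q + 2) (by simp) (by simp; lia)] at hm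
  obtain ⟨Z₁, π₁, _, l₁, hl₁⟩ := hm l h1 (-t)
    (by rw [Preadditive.neg_comp]; exact eq_neg_of_add_eq_zero_left h2)
  rw [epi_homologyMap_iff_up_to_refinements φ (q - 1) q (q + 1) (by simp) (by simp)] at he
  obtain ⟨Z₂, π₂, _, x, hx, y, hy⟩ := he (π₁ ≫ t + l₁ ≫ φ.f q) (by
    rw [Preadditive.add_comp, Category.assoc, Category.assoc, φ.comm, ← reassoc_of% hl₁,
      ← Preadditive.comp_add, add_comm (t ≫ _), h2, comp_zero])
  refine ⟨Z₂, π₂ ≫ π₁, inferInstance, (x - π₂ ≫ l₁) ≫ (inl φ).v q (q - 1) (by lia) +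
    y ≫ (inr φ).f (q - 1), ?_⟩
  rw [Preadditive.comp_add, ← Category.assoc, ← Category.assoc, eq_comp_d_iff]
  constructor
  · simp [hx, hl₁]
  · rw [Preadditive.sub_comp, sub_add_eq_add_sub, ← hy]
    simp

/-- In the long exact sequence the neighbours of H^q(T) → H^q(cone) are H^q(L) and H^{q+1}(L), and
both vanish. -/
lemma isIso_homologyMap_inr (q : ℤ) (h : L.ExactAt q) (h' : L.ExactAt (q + 1)) :
    IsIso (homologyMap (inr φ) q) := by
  have hm : Mono (homologyMap (inr φ) q) := by
    rw [mono_homologyMap_iff_up_to_refinements _ (q - 1) q (q + 1) (by simp) (by simp)]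
    intro Z t ht z hz
    obtain ⟨a, b, rfl⟩ := decomp_to φ z q (by lia)
    have h0 := (eq_comp_d_iff φ q 0 t a b).1 (by rw [← hz, zero_comp, zero_add])
    rw [exactAt_iff_exact_up_to_refinements _ (q - 1) q (q + 1) (by simp) (by simp)] at h
    obtain ⟨Z₁, π, _, e, he⟩ := h a (by simpa using h0.1.symm)
    refine ⟨Z₁, π, inferInstance, e ≫ φ.f _ + π ≫ b, ?_⟩
    rw [h0.2, Preadditive.comp_add, reassoc_of% he, Preadditive.add_comp]
    simp
  have he : Epi (homologyMap (inr φ) q) := by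
    rw [epi_homologyMap_iff_up_to_refinements _ (q - 1) q (q + 1) (by simp) (by simp)]
    intro Z z hz
    obtain ⟨l, t, rfl⟩ := decomp_to φ z (q + 1) rfl
    obtain ⟨h1, h2⟩ := (comp_d_eq_zero_iff φ q l t).1 hz
    rw [exactAt_iff_exact_up_to_refinements _ q (q + 1) (q + 2) (by simp) (by simp; lia)] at h'
    obtain ⟨Z₁, π₁, _, l₁, hl₁⟩ := h' l h1
    refine ⟨Z₁, π₁, inferInstance, π₁ ≫ t + l₁ ≫ φ.f q, ?_,
      (-l₁) ≫ (inl φ).v q (q - 1) (by lia), ?_⟩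
    · rw [Preadditive.add_comp, Category.assoc, Category.assoc, φ.comm, ← reassoc_of% hl₁,
        ← Preadditive.comp_add, add_comm (t ≫ _), h2, comp_zero]
    · have h3 := (eq_comp_d_iff φ q (π₁ ≫ l) (-(l₁ ≫ φ.f q)) (-l₁) 0).2 (by simp [hl₁])
      rw [zero_comp, add_zero] at h3
      rw [← h3]
      simp
      abel
  exact isIso_of_mono_of_epi _

end CochainComplex.mappingCone

namespace RefinedUnramified

open CategoryTheory Limits TopologicalSpace Opposite AlgebraicGeometry
open CochainComplex (mappingCone)

/-! ### Sections of a mapping cone as pairs of sections -/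

section Cone

variable {X : Scheme.{u}} {L T : CochainComplex (AbSheaf (zar X)) ℤ} (φ : L ⟶ T) {U V : Opens X}

/-- The section of the mapping cone given by a pair of sections. -/
noncomputable def coneMk {n m : ℤ} (h : n + 1 = m) (l : sec (L.X m) U) (t : sec (T.X n) U) :
    sec ((mappingCone φ).X n) U :=
  onSec ((mappingCone.inl φ).v m n (by lia)) U l + onSec ((mappingCone.inr φ).f n) U t

lemma exists_eq_coneMk {n m : ℤ} (h : n + 1 = m) (z : sec ((mappingCone φ).X n) U) :
    ∃ l t, z = coneMk φ h l t := by
  refine ⟨onSec ((mappingCone.fst φ).1.v n m h) U z, onSec ((mappingCone.snd φ).v n n (add_zero n)) U z, ?_⟩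
  rw [coneMk, ← onSec_comp, ← onSec_comp, ← onSec_add, mappingCone.id_X, onSec_id]

lemma res_coneMk {n m : ℤ} (h : n + 1 = m) (hV : V ≤ U) (l : sec (L.X m) U) (t : sec (T.X n) U) :
    res _ hV (coneMk φ h l t) = coneMk φ h (res _ hV l) (res _ hV t) := by
  simp [coneMk]

lemma coneMk_inj {n m : ℤ} (h : n + 1 = m) {l l' : sec (L.X m) U} {t t' : sec (T.X n) U} :
    coneMk φ h l t = coneMk φ h l' t' ↔ l = l' ∧ t = t' := by
  refine ⟨fun h0 ↦ ?_, by rintro ⟨rfl, rfl⟩; rfl⟩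
  have h1 := congr_arg (onSec ((mappingCone.fst φ).1.v n m h) U) h0
  have h2 := congr_arg (onSec ((mappingCone.snd φ).v n n (add_zero n)) U) h0
  simp only [coneMk, map_add, ← onSec_comp, mappingCone.inl_v_fst_v, mappingCone.inl_v_snd_v,
    mappingCone.inr_f_fst_v, mappingCone.inr_f_snd_v, onSec_zero, onSec_id, add_zero,
    zero_add] at h1 h2
  exact ⟨h1, h2⟩

lemma coneMk_sub {n m : ℤ} (h : n + 1 = m) (l l' : sec (L.X m) U) (t t' : sec (T.X n) U) :
    coneMk φ h l t - coneMk φ h l' t' = coneMk φ h (l - l') (t - t') := by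
  simp only [coneMk, map_sub]
  abel

lemma d_coneMk {n m k : ℤ} (h : n + 1 = m) (hk : m + 1 = k) (l : sec (L.X m) U)
    (t : sec (T.X n) U) :
    onSec ((mappingCone φ).d n m) U (coneMk φ h l t) =
      coneMk φ hk (-onSec (L.d m k) U l) (onSec (φ.f m) U l + onSec (T.d n m) U t) := by
  simp only [coneMk, map_add, ← onSec_comp]
  rw [mappingCone.inl_v_d φ m n k (by lia) (by lia), mappingCone.inr_f_d, sub_eq_add_neg,
    onSec_add, onSec_neg, map_neg]
  simp only [onSec_comp]
  abel

lemma isCocycle_coneMk {n m k : ℤ} (h : n + 1 = m) (hk : m + 1 = k) {l : sec (L.X m) U}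
    {t : sec (T.X n) U} :
    IsCocycle (mappingCone φ) (coneMk φ h l t) ↔
      IsCocycle L l ∧ onSec (φ.f m) U l + onSec (T.d n m) U t = 0 := by
  have h0 : coneMk φ hk (0 : sec _ U) 0 = 0 := by simp [coneMk]
  rw [isCocycle_iff h, d_coneMk φ h hk, isCocycle_iff hk, ← h0, coneMk_inj, neg_eq_zero]

lemma isCoboundary_coneMk {n m k : ℤ} (h : n + 1 = m) (hk : k + 1 = n) {l : sec (L.X m) U}
    {t : sec (T.X n) U} :
    IsCoboundary (mappingCone φ) (coneMk φ h l t) ↔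
      ∃ (l' : sec (L.X n) U) (t' : sec (T.X k) U), l = -onSec (L.d n m) U l' ∧
        t = onSec (φ.f n) U l' + onSec (T.d k n) U t' := by
  rw [isCoboundary_iff hk]
  constructor
  · rintro ⟨z, hz⟩
    obtain ⟨l', t', rfl⟩ := exists_eq_coneMk φ hk z
    rw [d_coneMk φ hk h, coneMk_inj] at hz
    exact ⟨l', t', hz.1.symm, hz.2.symm⟩
  · rintro ⟨l', t', rfl, rfl⟩
    exact ⟨coneMk φ hk l' t', d_coneMk φ hk h _ _⟩

variable {φ} in
lemma termwiseFlasque_mappingCone (hL : TermwiseFlasque L) (hT : TermwiseFlasque T) :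
    TermwiseFlasque (mappingCone φ) := by
  intro n U V h z
  obtain ⟨l, t, rfl⟩ := exists_eq_coneMk φ rfl z
  obtain ⟨l, rfl⟩ := hL _ h l
  obtain ⟨t, rfl⟩ := hT _ h t
  exact ⟨coneMk φ rfl l t, res_coneMk φ _ h l t⟩

end Cone

/-! ### Restriction to an open subset and the four lemma -/

section Descent

variable {X : Scheme.{u}}

/-- The restriction from `X` to `U` is injective on the cohomology of the sections of `M`
in degrees `≤ a`, and surjective in degrees `< a`. -/
def RestrictionBijective (M : CochainComplex (AbSheaf (zar X)) ℤ) (U : Opens X) (a : ℤ) : Prop :=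
  (∀ n ≤ a, ∀ m : sec (M.X n) ⊤, IsCocycle M m → IsCoboundary M (res _ le_top m : sec (M.X n) U) →
    IsCoboundary M m) ∧
  (∀ n < a, ∀ m : sec (M.X n) U, IsCocycle M m → ∃ m' : sec (M.X n) ⊤, IsCocycle M m' ∧
    IsCoboundary M (m - res _ le_top m'))

/-- This is the four lemma for H^{n-1}(C) → H^n(L) → H^n(T) → H^n(C) → H^{n+1}(L), with C the cone,
over X and over U. The asymmetric bounds n ≤ a and n < a in `RestrictionBijective` are exactly those
that it preserves. -/
lemma RestrictionBijective.of_mappingCone {L T : CochainComplex (AbSheaf (zar X)) ℤ} {φ : L ⟶ T}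
    {U : Opens X} {a : ℤ} (hL : RestrictionBijective L U a)
    (hC : RestrictionBijective (mappingCone φ) U a) : RestrictionBijective T U a := by
  constructor
  · intro n hn t ht ⟨t', ht'⟩
    have h₁ : n + 1 = n + 1 := rfl
    have h₀ : n - 1 + 1 = n := by lia
    obtain ⟨l, t₁, hl, rfl⟩ := (isCoboundary_coneMk φ h₁ h₀).1 (hC.1 n hn (coneMk φ h₁ 0 t)
      ((isCocycle_coneMk φ h₁ rfl).2 ⟨map_zero _, by rw [map_zero, zero_add]; exact ht⟩) (by
        rw [res_coneMk, isCoboundary_coneMk φ h₁ h₀]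
        exact ⟨0, t', by simp, by rw [map_zero, zero_add, ht']⟩))
    have hl' : IsCocycle L l := by simpa [IsCocycle] using hl.symm
    -- Over U the section t is both dt' and φ(l) + dt₁, so (l, t₁ - t') is a cocycle of the cone of
    -- degree n - 1. Extending its class to X corrects l by some l₁ such that φ(l₁) is a coboundary
    -- and l - l₁ vanishes in cohomology on U, hence on X.
    obtain ⟨z, hz, hz'⟩ := hC.2 (n - 1) (by lia) (coneMk φ h₀ (res _ le_top l)
      (res _ le_top t₁ - t')) ((isCocycle_coneMk φ h₀ rfl).2 ⟨hl'.restrict _, by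
        rw [map_sub, ht', onSec_res, onSec_res, map_add]
        abel⟩)
    obtain ⟨l₁, t₂, rfl⟩ := exists_eq_coneMk φ h₀ z
    obtain ⟨hl₁, ht₂⟩ := (isCocycle_coneMk φ h₀ rfl).1 hz
    rw [res_coneMk, coneMk_sub, isCoboundary_coneMk φ h₀ (k := n - 1 - 1) (by lia)] at hz'
    obtain ⟨l₂, t₃, hl₂, -⟩ := hz'
    obtain ⟨l₃, hl₃⟩ := hL.1 n hn (l - l₁) (hl'.sub hl₁)
      ⟨-l₂, by rw [map_neg, ← hl₂, map_sub]⟩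
    refine ⟨onSec (φ.f _) ⊤ l₃ - t₂ + t₁, ?_⟩
    rw [map_add, map_sub, ← onSec_f_d, hl₃, map_sub, eq_neg_of_add_eq_zero_left ht₂]
    abel
  · intro n hn t ht
    have h₁ : n + 1 = n + 1 := rfl
    have h₀ : n - 1 + 1 = n := by lia
    obtain ⟨z, hz, hz'⟩ := hC.2 n hn (coneMk φ h₁ 0 t) ((isCocycle_coneMk φ h₁ rfl).2
      ⟨map_zero _, by rw [map_zero, zero_add]; exact ht⟩)
    obtain ⟨l, t₁, rfl⟩ := exists_eq_coneMk φ h₁ z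
    obtain ⟨hl, ht₁⟩ := (isCocycle_coneMk φ h₁ rfl).1 hz
    rw [res_coneMk, coneMk_sub, isCoboundary_coneMk φ h₁ h₀] at hz'
    obtain ⟨l₁, t₂, hl₁, ht₂⟩ := hz'
    obtain ⟨l₂, hl₂⟩ := (isCoboundary_iff h₁).1 (hL.1 (n + 1) (by lia) l hl
      ((isCoboundary_iff h₁).2 ⟨l₁, by simpa using hl₁.symm⟩))
    -- Both l₁ over U and l₂ over X are primitives of l. Their difference is a cocycle, and its
    -- class extends to X.
    obtain ⟨l₃, hl₃, hl₃'⟩ := hL.2 n hn (l₁ - res _ le_top l₂) (by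
      rw [IsCocycle, map_sub, onSec_res, hl₂, sub_eq_zero]
      simpa using hl₁.symm)
    refine ⟨t₁ + onSec (φ.f n) ⊤ (l₂ + l₃), ?_, ?_⟩
    · rw [IsCocycle, map_add, ← onSec_f_d, map_add, hl₂, hl₃, add_zero]
      exact (add_comm _ _).trans ht₁
    · have h := (hl₃'.map φ).add (b := onSec (T.d (n - 1) n) U t₂) ⟨t₂, rfl⟩
      convert h using 1
      rw [map_add, sub_add_eq_sub_sub, ht₂]
      simp only [map_sub, map_add, onSec_res]
      abel

lemma RestrictionBijective.of_exactAt [NoetherianSpace X] (hd : topologicalKrullDim X ≠ ⊤) {M : CochainComplex (AbSheaf (zar X)) ℤ}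
    (hM : TermwiseFlasque M) {a : ℤ} (h : ∀ q ≤ a, M.ExactAt q) (U : Opens X) :
    RestrictionBijective M U a := by
  refine ⟨fun n hn m hm _ ↦ isCoboundary_of_exactAt_le hd hM (fun q hq ↦ h q (hq.trans hn)) hm,
    fun n hn m hm ↦ ⟨0, map_zero _, ?_⟩⟩
  rw [map_zero, sub_zero]
  exact isCoboundary_of_exactAt_le hd hM (fun q hq ↦ h q (hq.trans hn.le)) hm

end Descent

end RefinedUnramified

namespace KInjectiveResolution

open CategoryTheory Limits HomologicalComplex ZeroObject MorphismProperty

/-! ### K-injective replacements with injective terms -/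

section Disks

variable {A : Type u} [Category.{v} A] [Abelian A]

lemma acyclic_disk (E : A) (n : ℤ) : (disk E n).Acyclic := by
  intro k
  have hd := double_d (𝟙 E) (show (ComplexShape.up ℤ).Rel n (n + 1) from rfl) (by lia)
  have : IsIso ((disk E n).d n (n + 1)) := by
    rw [hd]
    infer_instance
  by_cases h₀ : k = n
  · subst h₀
    rw [exactAt_iff' _ (k - 1) k (k + 1) (by simp) (by simp)]
    have : Mono ((disk E k).sc' (k - 1) k (k + 1)).g := this.mono_of_iso
    exact (ShortComplex.exact_iff_mono _ (double_d_eq_zero₀ (𝟙 E)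
      (show (ComplexShape.up ℤ).Rel k (k + 1) from rfl) _ _ (by lia))).2 this
  · by_cases h₁ : k = n + 1
    · subst h₁
      rw [exactAt_iff' _ n (n + 1) (n + 1 + 1) (by simp) (by simp)]
      have : Epi ((disk E n).sc' n (n + 1) (n + 1 + 1)).f := this.epi_of_iso
      exact (ShortComplex.exact_iff_epi _ (double_d_eq_zero₀ (𝟙 E)
        (show (ComplexShape.up ℤ).Rel n (n + 1) from rfl) _ _ (by lia))).2 this
    · rw [exactAt_iff' _ (k - 1) k (k + 1) (by simp) (by simp)]
      exact ShortComplex.exact_of_isZero_X₂ _ (isZero_double_X (𝟙 E)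
        (show (ComplexShape.up ℤ).Rel n (n + 1) from rfl) _ h₀ h₁)

/-- Lifting against these morphisms of disks amounts to extending morphisms E ⟶ I.X n along f, which
gives the injectivity of the terms of I. -/
lemma acyclicMono_fromDisk {E E' : A} (f : E ⟶ E') [Mono f] (n : ℤ) :
    acyclicMono (fromDisk (Y := disk E' n) (f ≫ (doubleXIso₀ (𝟙 E') _).inv)) := by
  have hd := double_d (𝟙 E') (show (ComplexShape.up ℤ).Rel n (n + 1) from rfl) (by lia)
  refine ⟨mono_of_mono_f _ fun k ↦ ?_, ⟨fun k ↦ ?_⟩⟩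
  · by_cases h₀ : k = n
    · subst h₀
      rw [fromDisk, mkHomFromDouble_f₀]
      infer_instance
    · by_cases h₁ : k = n + 1
      · subst h₁
        rw [fromDisk, mkHomFromDouble_f₁, hd]
        simp only [Category.assoc, Iso.inv_hom_id_assoc, Category.id_comp]
        infer_instance
      · exact ⟨fun _ _ _ ↦ (isZero_double_X (𝟙 E) _ k h₀ h₁).eq_of_tgt _ _⟩
  · rw [quasiIsoAt_iff_isIso_homologyMap]
    exact ((exactAt_iff_isZero_homology _ _).1 (acyclic_disk E n k)).isIso
      ((exactAt_iff_isZero_homology _ _).1 (acyclic_disk E' n k)) _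

lemma injective_X_of_rlp (I : CochainComplex A ℤ) (hI : acyclicMono.rlp (0 : I ⟶ 0)) (n : ℤ) :
    Injective (I.X n) where
  factors {E E'} g f _ := by
    have := hI _ (acyclicMono_fromDisk f n)
    have sq : CommSq (fromDisk g) (fromDisk (Y := disk E' n) (f ≫ (doubleXIso₀ (𝟙 E') _).inv))
      (0 : I ⟶ 0) 0 := ⟨by simp⟩
    refine ⟨(doubleXIso₀ (𝟙 E') _).inv ≫ sq.lift.f n, ?_⟩
    have h := congr_arg (fun a ↦ (doubleXIso₀ (𝟙 E) _).inv ≫ a.f n) sq.fac_left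
    dsimp at h
    rw [fromDisk_f g, ← Category.assoc, fromDisk_f, Category.assoc] at h
    exact h

end Disks

variable {A : Type u} [Category.{v} A] [Abelian A] [IsGrothendieckAbelian.{w} A]

/-- Every complex in a Grothendieck abelian category has a K-injective replacement with
injective terms. -/
theorem exists_kInjective_injective (K : CochainComplex A ℤ) :
    ∃ (I : CochainComplex A ℤ) (f : K ⟶ I), QuasiIso f ∧ I.IsKInjective ∧
      ∀ n, Injective (I.X n) := by
  obtain ⟨L, hL⟩ := exists_generators.{w} A
  let fac := (functorialFactorizationData (generators L).rlp.llp (generators L).rlp).factorizationData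
    (0 : K ⟶ 0)
  have h : acyclicMono.rlp (0 : fac.Z ⟶ 0) := by
    have h := fac.hp
    rw [(isZero_zero (CochainComplex A ℤ)).eq_of_tgt fac.p 0] at h
    exact antitone_rlp hL _ ((le_llp_iff_le_rlp _ _).1 le_rfl _ h)
  exact ⟨fac.Z, fac.i, (llp_rlp_generators_le.{w} L _ fac.hi).2, isKInjective_of_rlp _ h,
    injective_X_of_rlp _ h⟩

end KInjectiveResolution

namespace RefinedUnramified

open CategoryTheory Limits TopologicalSpace Opposite AlgebraicGeometry
open CochainComplex (mappingCone)

/-! ### Sections of injective sheaves and morphisms to K-injective complexes -/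

section Injective

variable {C : Type u} [SmallCategory C] {J : GrothendieckTopology C}

/-- The sections of an injective sheaf extend along monomorphisms. -/
lemma surjective_map_of_injective (G : AbSheaf J) [Injective G] {U V : C} (f : U ⟶ V) [Mono f] :
    Function.Surjective (G.obj.map f.op) := by
  intro a
  -- G is also injective as a presheaf, because sheafification preserves monomorphisms.
  have : Injective G.obj :=
    Injective.injective_of_adjoint (sheafificationAdjunction J AddCommGrpCat.{u}) G
  let adj := AddCommGrpCat.adj.{u}.whiskerRight Cᵒᵖ
  -- Sections over U are morphisms from the free abelian presheaf on the presheaf represented by U.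
  -- A monomorphism f induces a monomorphism ι of these presheaves, along which φ extends.
  let φ : yoneda.obj U ⋙ AddCommGrpCat.free ⟶ G.obj :=
    (adj.homEquiv _ _).symm (yonedaEquiv.symm a)
  let ι : yoneda.obj U ⋙ AddCommGrpCat.free ⟶ yoneda.obj V ⋙ AddCommGrpCat.free :=
    Functor.whiskerRight (yoneda.map f) _
  have : Mono ι := by
    have (W : Cᵒᵖ) : Mono (ι.app W) := inferInstanceAs (Mono (AddCommGrpCat.free.map _))
    exact NatTrans.mono_of_mono_app _
  have h : ι ≫ Injective.factorThru φ ι = φ := Injective.comp_factorThru _ _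
  refine ⟨yonedaEquiv (adj.homEquiv (yoneda.obj V) G.obj (Injective.factorThru φ ι)), ?_⟩
  refine (yonedaEquiv_naturality (adj.homEquiv (yoneda.obj V) G.obj (Injective.factorThru φ ι))
    f).trans ?_
  have h' := adj.homEquiv_naturality_left (yoneda.map f) (Injective.factorThru φ ι)
  rw [← h']
  exact (congr_arg (fun t ↦ yonedaEquiv (adj.homEquiv _ _ t)) h).trans (by simp [φ])

end Injective

section KInjective

variable {A : Type u} [Category.{v} A] [Abelian A]

/-- Morphisms to K-injective complexes extend along quasi-isomorphisms, up to homotopy. -/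
lemma exists_extension {K L I : CochainComplex A ℤ} [I.IsKInjective] (u : K ⟶ L) [QuasiIso u]
    (w : K ⟶ I) : ∃ ψ : L ⟶ I, Nonempty (Homotopy (u ≫ ψ) w) := by
  -- In the derived category u can be inverted, and morphisms to a K-injective complex there are
  -- homotopy classes of morphisms of complexes.
  let := HasDerivedCategory.standard A
  have : IsIso (DerivedCategory.Qh.map ((HomotopyCategory.quotient _ _).map u)) :=
    (NatIso.isIso_map_iff (DerivedCategory.quotientCompQhIso A) u).2 inferInstance
  obtain ⟨g, hg⟩ := (CochainComplex.IsKInjective.Qh_map_bijective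
    ((HomotopyCategory.quotient _ _).obj L) I).surjective
    (inv (DerivedCategory.Qh.map ((HomotopyCategory.quotient _ _).map u)) ≫
      DerivedCategory.Qh.map ((HomotopyCategory.quotient _ _).map w))
  obtain ⟨ψ, rfl⟩ := (HomotopyCategory.quotient _ _).map_surjective g
  refine ⟨ψ, ⟨HomotopyCategory.homotopyOfEq _ _ ?_⟩⟩
  apply (CochainComplex.IsKInjective.Qh_map_bijective _ _).injective
  rw [Functor.map_comp, Functor.map_comp, hg]
  simp

end KInjective
end RefinedUnramified

namespace RefinedUnramified

open CategoryTheory Limits TopologicalSpace Opposite AlgebraicGeometry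
open CochainComplex (mappingCone)

/-! ### Direct sums of sheaves on a Noetherian space -/

section Coproducts

variable {X : Scheme.{u}} {ι : Type u} (G : ι → AbSheaf (zar X))

open scoped Classical DirectSum

/-- The direct sum of a family of sheaves, as a presheaf. -/
noncomputable def directSumPresheaf : (Opens X)ᵒᵖ ⥤ AddCommGrpCat.{u} where
  obj U := .of (⨁ s, (G s).obj.obj U)
  map f := AddCommGrpCat.ofHom (DirectSum.map fun s ↦ ((G s).obj.map f).hom)
  map_id U := by
    ext : 1
    refine DirectSum.addHom_ext fun s b ↦ ?_
    simp
  map_comp f g := by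
    ext : 1
    refine DirectSum.addHom_ext fun s b ↦ ?_
    simp

/-- The morphism from the direct sum of presheaves to the coproduct of sheaves. -/
noncomputable def fromDirectSum : directSumPresheaf G ⟶ (∐ G).obj where
  app U := AddCommGrpCat.ofHom
    (DirectSum.toAddMonoid fun s ↦ ((Sigma.ι G s).hom.app U).hom)
  naturality U V f := by
    ext : 1
    refine DirectSum.addHom_ext fun s b ↦ ?_
    simp [directSumPresheaf]

lemma fromDirectSum_of (U : (Opens X)ᵒᵖ) (s : ι) (b : (G s).obj.obj U) :
    ((fromDirectSum G).app U).hom (DirectSum.of (fun s ↦ (G s).obj.obj U) s b) =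
      ((Sigma.ι G s).hom.app U).hom b :=
  DirectSum.toAddMonoid_of _ _ _

lemma directSumPresheaf_map_of {U V : (Opens X)ᵒᵖ} (f : U ⟶ V) (s : ι) (b : (G s).obj.obj U) :
    ((directSumPresheaf G).map f).hom (DirectSum.of (fun s ↦ (G s).obj.obj U) s b) =
      DirectSum.of (fun s ↦ (G s).obj.obj V) s (((G s).obj.map f).hom b) :=
  DirectSum.map_of _ _ _

/-- A morphism to a sheaf from either side is a family of morphisms from the summands. So the
coproduct is the sheafification of the presheaf direct sum, and the comparison map is locally
bijective. -/
lemma w_fromDirectSum : (zar X).W (fromDirectSum G) := by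
  intro H hH
  constructor
  · intro g g' h
    have : (ObjectProperty.homMk g : ∐ G ⟶ ⟨H, hH⟩) = ObjectProperty.homMk g' := by
      refine Sigma.hom_ext _ _ fun s ↦ ?_
      ext U b
      have := ConcreteCategory.congr_hom (NatTrans.congr_app h U) (DirectSum.of _ s b)
      exact (congr_arg (g.app U).hom (fromDirectSum_of G U s b)).symm.trans
        (this.trans (congr_arg (g'.app U).hom (fromDirectSum_of G U s b)))
    exact congr_arg (fun t ↦ t.hom) this
  · intro h
    let g (s : ι) : G s ⟶ ⟨H, hH⟩ := ObjectProperty.homMk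
      { app U := AddCommGrpCat.ofHom ((h.app U).hom.comp (DirectSum.of (fun s ↦ (G s).obj.obj U) s))
        naturality U V f := by
          ext b
          have := ConcreteCategory.congr_hom (h.naturality f) (DirectSum.of _ s b)
          exact (congr_arg (h.app V).hom (directSumPresheaf_map_of G f s b)).symm.trans this }
    refine ⟨(Sigma.desc g).hom, ?_⟩
    ext U : 3
    refine DirectSum.addHom_ext fun s b ↦ ?_
    have : Sigma.ι G s ≫ Sigma.desc g = g s := Sigma.ι_desc _ _
    have := ConcreteCategory.congr_hom (NatTrans.congr_app (congr_arg (fun t ↦ t.hom) this) U) b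
    exact (congr_arg ((Sigma.desc g).hom.app U).hom (fromDirectSum_of G U s b)).trans this

lemma exists_local_sum {U : Opens X} (a : sec (∐ G) U) {x : X} (hx : x ∈ U) :
    ∃ (V : Opens X) (hV : V ≤ U) (b : ⨁ s, sec (G s) V), x ∈ V ∧
      res _ hV a = DirectSum.toAddMonoid (fun s ↦ onSec (Sigma.ι G s) V) b := by
  have h : Presheaf.IsLocallySurjective (zar X) (fromDirectSum G) :=
    ((zar X).W_iff_isLocallyBijective _).1 (w_fromDirectSum G) |>.2
  obtain ⟨V, hV, ⟨b, hb⟩, hxV⟩ :=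
    (TopCat.Presheaf.isLocallySurjective_iff (X := X.toTopCat) _).1 h U a x hx
  exact ⟨V, hV, b, hxV, hb.symm⟩

/-- On a Noetherian space, a section of a coproduct of sheaves has only finitely many nonzero
components, and is their sum. -/
lemma exists_eq_sum [NoetherianSpace X] {U : Opens X} (a : sec (∐ G) U) :
    ∃ S : Finset ι, a = ∑ s ∈ S, onSec (Sigma.ι G s) U (onSec (Sigma.π G s) U a) := by
  choose! V hV b hxV hb using fun x (hx : x ∈ U) ↦ exists_local_sum G a hx
  -- Since U is quasi-compact, finitely many local finite sums describe a, and the union of their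
  -- supports is finite.
  obtain ⟨t, ht⟩ := (NoetherianSpace.isCompact (U : Set X)).elim_finite_subcover
    (fun x : U ↦ (V x : Set X)) (fun x ↦ (V x).isOpen)
    (fun x hx ↦ Set.mem_iUnion.2 ⟨⟨x, hx⟩, hxV x hx⟩)
  refine ⟨t.biUnion fun x ↦ (b x).support, sec_ext_of_locally fun x hx ↦ ?_⟩
  obtain ⟨y, hy, hxy⟩ := Set.mem_iUnion₂.1 (ht hx)
  refine ⟨V y, hV y y.2, hxy, ?_⟩
  have hb' : res _ (hV y y.2) a = ∑ s ∈ (b y).support, onSec (Sigma.ι G s) (V y) (b y s) := by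
    rw [hb y y.2]
    exact DFinsupp.sumAddHom_apply _ _
  have hπ (s : ι) : onSec (Sigma.π G s) (V y) (res _ (hV y y.2) a) = b y s := by
    rw [hb', map_sum, Finset.sum_eq_single s]
    · rw [← onSec_comp, Sigma.ι_π_eq_id, onSec_id]
    · intro s' _ hs'
      rw [← onSec_comp, Sigma.ι_π_of_ne _ hs', onSec_zero]
    · intro hs
      rw [DFinsupp.notMem_support_iff.1 hs, map_zero, map_zero]
  rw [map_sum]
  simp only [← onSec_res, hπ]
  rw [hb']
  refine Finset.sum_subset (Finset.subset_biUnion_of_mem (fun x : U ↦ (b x).support) hy)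
    fun s _ hs ↦ ?_
  rw [DFinsupp.notMem_support_iff.1 hs, map_zero]

end Coproducts

/-! ### Constant sheaves on closures of points -/

section PointSheaf

variable {X : Scheme.{u}} (x : X) (A : AddCommGrpCat.{u})

open scoped Classical in
lemma isIso_map_pointSheaf {U V : Opens X} (h : V ≤ U) (hx : x ∈ V) :
    IsIso ((pointSheaf x A).obj.map (homOfLE h).op) := by
  have : (pointSheaf x A).obj.map (homOfLE h).op = eqToHom (by
      simp only [pointSheaf, skyscraperSheaf_obj_obj]
      rw [if_pos (show x ∈ U from h hx), if_pos (show x ∈ V from hx)]) :=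
    dif_pos (show x ∈ V from hx)
  rw [this]
  infer_instance

lemma injective_res_pointSheaf {U V : Opens X} (h : V ≤ U) (hx : x ∈ V) :
    Function.Injective (res (pointSheaf x A) h) := by
  have := isIso_map_pointSheaf x A h hx
  exact (ConcreteCategory.bijective_of_isIso ((pointSheaf x A).obj.map (homOfLE h).op)).1

open scoped Classical in
-- If x ∈ V, then the restriction is an isomorphism; otherwise its target is zero.
lemma flasque_pointSheaf : Flasque (pointSheaf x A) := by
  intro U V h
  by_cases hx : x ∈ V
  · have := isIso_map_pointSheaf x A h hx
    exact (ConcreteCategory.bijective_of_isIso ((pointSheaf x A).obj.map (homOfLE h).op)).2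
  · have h0 : IsZero ((pointSheaf x A).obj.obj (op V)) := by
      refine IsZero.of_iso (isZero_zero _) ?_
      exact (isTerminalSkyscraperSheafObjObjOfNotMem (X := X.toTopCat) (p₀ := x) (A := A)
        (U := op V) hx).uniqueUpToIso HasZeroObject.zeroIsTerminal
    have := AddCommGrpCat.subsingleton_of_isZero h0
    exact fun a ↦ ⟨0, Subsingleton.elim _ _⟩

end PointSheaf

section Coproducts

variable {X : Scheme.{u}}

open scoped Classical in
-- Only finitely many components of a section are nonzero, so they can be extended one by one and
-- summed.
lemma flasque_sigma [NoetherianSpace X] {ι : Type u} (G : ι → AbSheaf (zar X)) (hG : ∀ s, Flasque (G s)) :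
    Flasque (∐ G) := by
  intro U V h a
  obtain ⟨S, hS⟩ := exists_eq_sum G a
  choose b hb using fun s ↦ hG s h (onSec (Sigma.π G s) V a)
  refine ⟨∑ s ∈ S, onSec (Sigma.ι G s) U (b s), ?_⟩
  rw [map_sum, hS]
  refine Finset.sum_congr rfl fun s _ ↦ ?_
  rw [← onSec_res, hb]

open scoped Classical in
lemma injective_res_sigma [NoetherianSpace X] {ι : Type u} (G : ι → AbSheaf (zar X)) {U V : Opens X} (h : V ≤ U)
    (hG : ∀ s, Function.Injective (res (G s) h)) : Function.Injective (res (∐ G) h) := by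
  rw [injective_iff_map_eq_zero]
  intro a ha
  obtain ⟨S, hS⟩ := exists_eq_sum G a
  rw [hS]
  refine Finset.sum_eq_zero fun s _ ↦ ?_
  rw [(injective_iff_map_eq_zero _).1 (hG s) (onSec (Sigma.π G s) U a)
    (by rw [← onSec_res, ha, map_zero]), map_zero]

lemma Flasque.of_iso {G H : AbSheaf (zar X)} (e : G ≅ H) (hH : Flasque H) : Flasque G := by
  intro U V h a
  obtain ⟨b, hb⟩ := hH h (onSec e.hom V a)
  refine ⟨onSec e.inv U b, ?_⟩
  rw [← onSec_res, hb, ← onSec_comp, e.hom_inv_id, onSec_id]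

lemma injective_res_of_iso {G H : AbSheaf (zar X)} (e : G ≅ H) {U V : Opens X} (h : V ≤ U)
    (hH : Function.Injective (res H h)) : Function.Injective (res G h) := by
  intro a b hab
  have h1 := congr_arg (onSec e.hom V) hab
  rw [onSec_res, onSec_res] at h1
  have h2 := congr_arg (onSec e.inv U) (hH h1)
  rwa [← onSec_comp, ← onSec_comp, e.hom_inv_id, onSec_id, onSec_id] at h2

end Coproducts

end RefinedUnramified

namespace RefinedUnramified

open CategoryTheory Limits TopologicalSpace Opposite AlgebraicGeometry HomologicalComplex
open CochainComplex (mappingCone)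

/-! ### Cohomology of cones and transport of restriction properties -/

section Abelian

variable {A : Type u} [Category.{v} A] [Abelian A]

lemma isIso_homologyMap {K L : CochainComplex A ℤ} (φ : K ⟶ L) (hφ : QuasiIso φ) (q : ℤ) :
    IsIso (homologyMap φ q) := inferInstance

lemma quasiIso_comp {K L M : CochainComplex A ℤ} (φ : K ⟶ L) (ψ : L ⟶ M) (hφ : QuasiIso φ)
    (hψ : QuasiIso ψ) : QuasiIso (φ ≫ ψ) := inferInstance

lemma exactAt_iff_of_quasiIso {K L : CochainComplex A ℤ} (φ : K ⟶ L) (hφ : QuasiIso φ) (q : ℤ) :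
    K.ExactAt q ↔ L.ExactAt q :=
  exactAt_iff_of_quasiIsoAt φ q

lemma mappingCone_exactAt_of_quasiIso {K L : CochainComplex A ℤ} (φ : K ⟶ L) (hφ : QuasiIso φ)
    (q : ℤ) : (mappingCone φ).ExactAt q :=
  CochainComplex.mappingCone.exactAt_of_epi_of_mono φ q inferInstance inferInstance

/-- A morphism from a single object to a complex in degrees `≥ 0`, shifted. -/
noncomputable def singleToExtend {G : A} {E : CochainComplex A ℕ}
    (ε : (CochainComplex.single₀ A).obj G ⟶ E) (q : ℤ) :
    (single A (.up ℤ) q).obj G ⟶ E.extend (ComplexShape.embeddingUpIntGE q) :=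
  (extendSingleIso (ComplexShape.embeddingUpIntGE q) G 0 q (by simp)).inv ≫
    extendMap ε (ComplexShape.embeddingUpIntGE q)

lemma quasiIso_singleToExtend {G : A} {E : CochainComplex A ℕ}
    (ε : (CochainComplex.single₀ A).obj G ⟶ E) (hε : QuasiIso ε) (q : ℤ) :
    QuasiIso (singleToExtend ε q) := by
  have : QuasiIso (extendMap ε (ComplexShape.embeddingUpIntGE q)) :=
    (quasiIso_extendMap_iff _ _).2 inferInstance
  dsimp [singleToExtend]
  infer_instance

lemma isIso_homologyMap_of_homotopy {S R I : CochainComplex A ℤ} {ε : S ⟶ R} (hε : QuasiIso ε)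
    {ψ : R ⟶ I} {w : S ⟶ I} (h : Homotopy (ε ≫ ψ) w) {t : ℤ} (hw : IsIso (homologyMap w t)) :
    IsIso (homologyMap ψ t) := by
  have h1 := h.homologyMap_eq t
  rw [homologyMap_comp] at h1
  exact IsIso.of_isIso_fac_left h1

/-- Below degree t neither complex has cohomology; in degree t the map ψ is an isomorphism on
cohomology, and R has none in degree t + 1. So cohomology of the cone can start only in degree t +
1. -/
lemma mappingCone_exactAt_of_lt {R I : CochainComplex A ℤ} (ψ : R ⟶ I) {t : ℤ}
    (hψ : IsIso (homologyMap ψ t)) (hR : ∀ q ≠ t, R.ExactAt q) (hI : ∀ q < t, I.ExactAt q) {q : ℤ}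
    (hq : q < t + 1) : (mappingCone ψ).ExactAt q := by
  apply CochainComplex.mappingCone.exactAt_of_epi_of_mono
  · by_cases h : q = t
    · subst h
      infer_instance
    · exact ⟨fun _ _ _ ↦ ((exactAt_iff_isZero_homology _ _).1 (hI q (by lia))).eq_of_src _ _⟩
  · by_cases h : q + 1 = t
    · subst h
      infer_instance
    · exact ⟨fun _ _ _ ↦ ((exactAt_iff_isZero_homology _ _).1 (hR (q + 1) h)).eq_of_tgt _ _⟩

lemma isIso_homologyMap_comp {K L M : CochainComplex A ℤ} (φ : K ⟶ L) (ψ : L ⟶ M) {q : ℤ}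
    (hφ : IsIso (homologyMap φ q)) (hψ : IsIso (homologyMap ψ q)) :
    IsIso (homologyMap (φ ≫ ψ) q) := by
  rw [homologyMap_comp]
  infer_instance

end Abelian

section QuasiIso

variable {X : Scheme.{u}} {M N : CochainComplex (AbSheaf (zar X)) ℤ}

/-- The cone of φ is acyclic and termwise flasque, so its sections over any open set are exact.
Therefore φ induces isomorphisms on the cohomology of sections over X and over U. -/
lemma RestrictionBijective.of_quasiIso [NoetherianSpace X] (hd : topologicalKrullDim X ≠ ⊤)
    (hM : TermwiseFlasque M) (hN : TermwiseFlasque N) (φ : M ⟶ N) [QuasiIso φ] {U : Opens X}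
    {a : ℤ} (h : RestrictionBijective N U a) : RestrictionBijective M U a := by
  have hC (q : ℤ) : (mappingCone φ).ExactAt q :=
    mappingCone_exactAt_of_quasiIso φ ‹_› q
  have hF : TermwiseFlasque (mappingCone φ) := termwiseFlasque_mappingCone hM hN
  have inj {V : Opens X} {n : ℤ} {l : sec (M.X n) V} (hl : IsCocycle M l)
      (hl' : IsCoboundary N (onSec (φ.f n) V l)) : IsCoboundary M l := by
    obtain ⟨t, ht⟩ := hl'
    obtain ⟨l', t', h1, -⟩ := (isCoboundary_coneMk φ (n := n - 1) (by lia) (k := n - 1 - 1)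
      (by lia)).1 (isCoboundary_of_exactAt_le hd hF (fun q _ ↦ hC q)
        ((isCocycle_coneMk φ (n := n - 1) (by lia) rfl).2
          (⟨hl, by rw [map_neg, ht, add_neg_cancel]⟩ : IsCocycle M l ∧ _ + onSec _ V (-t) = 0)))
    exact ⟨-l', by rw [h1, map_neg]⟩
  have surj {V : Opens X} {n : ℤ} {t : sec (N.X n) V} (ht : IsCocycle N t) :
      ∃ l : sec (M.X n) V, IsCocycle M l ∧ IsCoboundary N (t - onSec (φ.f n) V l) := by
    obtain ⟨l, t', h1, h2⟩ := (isCoboundary_coneMk φ (n := n) rfl (k := n - 1)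
      (by lia)).1 (isCoboundary_of_exactAt_le hd hF (fun q _ ↦ hC q)
        ((isCocycle_coneMk φ (n := n) rfl rfl).2
          (⟨map_zero _, by rw [map_zero, zero_add]; exact ht⟩ : IsCocycle M 0 ∧ _)))
    refine ⟨l, by simpa [IsCocycle] using h1.symm, t', ?_⟩
    rw [h2]
    abel
  constructor
  · intro n hn m hm hm'
    refine inj hm (h.1 n hn _ (hm.map φ) ?_)
    rw [← onSec_res]
    exact hm'.map φ
  · intro n hn m hm
    obtain ⟨t, ht, ht'⟩ := h.2 n hn _ (hm.map φ)
    obtain ⟨l, hl, hl'⟩ := surj ht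
    refine ⟨l, hl, inj (hm.sub (hl.restrict _)) ?_⟩
    have h1 := ht'.add (hl'.restrict (le_top : U ≤ ⊤))
    rw [map_sub, sub_add_sub_cancel] at h1
    rwa [map_sub, onSec_res]

/-- In degrees ≤ a the restriction is bijective on sections, by flasqueness. Surjectivity on
cohomology needs n < a, because an extended section is seen to be a cocycle in degree n + 1. -/
lemma RestrictionBijective.of_injective_res (hM : TermwiseFlasque M) {U : Opens X} {a : ℤ}
    (h : ∀ n ≤ a, Function.Injective (res (M.X n) (le_top : U ≤ ⊤))) :
    RestrictionBijective M U a := by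
  constructor
  · rintro n hn m hm ⟨b, hb⟩
    obtain ⟨b, rfl⟩ := hM _ (le_top : U ≤ ⊤) b
    exact ⟨b, h n hn (by rw [← onSec_res, hb])⟩
  · intro n hn m hm
    obtain ⟨m, rfl⟩ := hM _ (le_top : U ≤ ⊤) m
    refine ⟨m, h (n + 1) (by lia) ?_, ?_⟩
    · rw [← onSec_res, map_zero]
      exact hm
    · rw [sub_self]
      exact isCoboundary_zero

end QuasiIso

/-! ### The lowest cohomology object of a complex -/

section Single

variable {A : Type u} [Category.{v} A] [Abelian A]

/-- In the lowest degree t the cohomology is the kernel of the differential, hence a subobject of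
the term itself. -/
lemma exists_single_hom (K : CochainComplex A ℤ) (t : ℤ) [K.IsStrictlyGE t] :
    ∃ w : (single A (.up ℤ) t).obj (K.homology t) ⟶ K, IsIso (homologyMap w t) := by
  have h0 : IsZero (K.X (t - 1)) := K.isZero_of_isStrictlyGE t (t - 1)
  have : IsIso (K.homologyπ t) := K.isIso_homologyπ (t - 1) t (by simp) (h0.eq_of_src _ _)
  let w : (single A (.up ℤ) t).obj (K.homology t) ⟶ K :=
    mkHomFromSingle (inv (K.homologyπ t) ≫ K.iCycles t) (by simp)
  have hw : w.f t = (singleObjXSelf (.up ℤ) t _).hom ≫ inv (K.homologyπ t) ≫ K.iCycles t :=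
    mkHomFromSingle_f _ _
  refine ⟨w, ?_⟩
  have : Mono (homologyMap w t) := by
    rw [mono_homologyMap_iff_up_to_refinements _ (t - 1) t (t + 1) (by simp) (by simp)]
    intro Z x _ y hy
    have : Mono (w.f t) := by rw [hw]; infer_instance
    have hx : x = 0 := by
      rw [← cancel_mono (w.f t), hy, h0.eq_of_tgt y 0, zero_comp, zero_comp]
    exact ⟨Z, 𝟙 Z, inferInstance, 0, by rw [hx, zero_comp, comp_zero]⟩
  have : Epi (homologyMap w t) := by
    rw [epi_homologyMap_iff_up_to_refinements _ (t - 1) t (t + 1) (by simp) (by simp)]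
    intro Z y hy
    refine ⟨Z, 𝟙 Z, inferInstance, K.liftCycles y (t + 1) (by simp) hy ≫ K.homologyπ t ≫
      (singleObjXSelf (.up ℤ) t _).inv, by simp, 0, ?_⟩
    simp [hw]
  exact isIso_of_mono_of_epi _

end Single

/-! ### Gersten complexes -/

section Gersten

variable {X : Scheme.{u}}

/-- The transport of a resolution along an isomorphism. -/
noncomputable def GerstenResolution.ofIso {G H : AbSheaf (zar X)} {A : ℕ → X → AddCommGrpCat.{u}}
    (R : GerstenResolution G A) (e : H ≅ G) : GerstenResolution H A where
  E := R.E
  iso := R.iso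
  ε := (CochainComplex.single₀ (AbSheaf (zar X))).map e.hom ≫ R.ε
  quasiIso := by
    have := R.quasiIso
    infer_instance

variable {G : AbSheaf (zar X)} {A : ℕ → X → AddCommGrpCat.{u}} (R : GerstenResolution G A)

/-- The complex of a resolution, starting in degree `q`. -/
noncomputable def GerstenResolution.complexGE (q : ℤ) : CochainComplex (AbSheaf (zar X)) ℤ :=
  R.E.extend (ComplexShape.embeddingUpIntGE q)

/-- The augmentation of the complex starting in degree `q`. -/
noncomputable def GerstenResolution.augmentation (q : ℤ) :
    (single (AbSheaf (zar X)) (.up ℤ) q).obj G ⟶ R.complexGE q :=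
  singleToExtend R.ε q

lemma GerstenResolution.quasiIso_augmentation (q : ℤ) : QuasiIso (R.augmentation q) :=
  quasiIso_singleToExtend R.ε R.quasiIso q

lemma sec_eq_zero_of_isZero (hG : IsZero G) {U : Opens X} (a : sec G U) : a = 0 := by
  rw [← onSec_id a, hG.eq_of_src (𝟙 G) 0, onSec_zero]

lemma GerstenResolution.X_cases (q n : ℤ) : IsZero ((R.complexGE q).X n) ∨
    ∃ p : ℕ, q + p = n ∧ Nonempty ((R.complexGE q).X n ≅ R.E.X p) := by
  by_cases h : n < q
  · exact Or.inl (isZero_extend_X _ _ _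
      ((ComplexShape.notMem_range_embeddingUpIntGE_iff q n).2 h))
  · obtain ⟨p, hp⟩ := Int.eq_ofNat_of_zero_le (show 0 ≤ n - q by lia)
    exact Or.inr ⟨p, by lia, ⟨extendXIso _ _ (show q + (p : ℤ) = n by lia)⟩⟩

lemma GerstenResolution.termwiseFlasque [NoetherianSpace X] (q : ℤ) :
    TermwiseFlasque (R.complexGE q) := by
  intro n
  obtain h | ⟨p, -, ⟨e⟩⟩ := R.X_cases q n
  · exact fun U V _ a ↦ ⟨0, by rw [sec_eq_zero_of_isZero h a, map_zero]⟩
  · exact .of_iso (e ≪≫ R.iso p) (flasque_sigma _ fun x ↦ flasque_pointSheaf _ _)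

/-- The term in degree n is a sum over points of codimension n - q. For n ≤ a this codimension is at
most m, so these points lie in U and restriction to U loses no section. -/
lemma GerstenResolution.restrictionBijective [NoetherianSpace X] (q : ℤ) {m a : ℤ} {U : Opens X}
    (hU : F X m ⊆ U) (ha : a ≤ m + q) : RestrictionBijective (R.complexGE q) U a := by
  refine .of_injective_res (R.termwiseFlasque q) fun n hn ↦ ?_
  obtain h | ⟨p, hp, ⟨e⟩⟩ := R.X_cases q n
  · exact fun a b _ ↦ by rw [sec_eq_zero_of_isZero h a, sec_eq_zero_of_isZero h b]
  · exact injective_res_of_iso (e ≪≫ R.iso p) _ (injective_res_sigma _ _ fun x ↦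
      injective_res_pointSheaf _ _ _ (hU ⟨p, x.2, by lia⟩))

lemma GerstenResolution.exactAt (q n : ℤ) (hn : n ≠ q) : (R.complexGE q).ExactAt n :=
  (exactAt_iff_of_quasiIso _ (R.quasiIso_augmentation q) n).1
    (exactAt_single_obj _ _ _ _ hn)

end Gersten

/-! ### Dévissage along the cohomology sheaves -/

section Devissage

variable {X : Scheme.{u}}

lemma flasque_of_injective (G : AbSheaf (zar X)) [Injective G] : Flasque G :=
  fun _ _ h ↦ surjective_map_of_injective G (homOfLE h)

variable [NoetherianSpace X]

/-- If the cohomology sheaves of `M` vanish in degrees below `t` and have resolutions by sums of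
constant sheaves on closures of points in the degrees `≥ t`, then the cohomology of the sections
of `M` does not change in degrees `< m + t` if one removes a closed subset of codimension
greater than `m`. -/
theorem restrictionBijective_of_gersten (hd : topologicalKrullDim X ≠ ⊤) {m : ℤ} {U : Opens X}
    (hU : F X m ⊆ U) {M : CochainComplex (AbSheaf (zar X)) ℤ} (hM : TermwiseFlasque M) {a t : ℤ}
    (hat : a ≤ m + t) (hMt : ∀ q < t, M.ExactAt q)
    (hG : ∀ q, t ≤ q → ∃ A : ℕ → X → AddCommGrpCat.{u},
      Nonempty (GerstenResolution (M.homology q) A)) :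
    RestrictionBijective M U a := by
  -- The induction is on the number of degrees t, …, a in which cohomology of M may matter; at zero,
  -- M is exact in all degrees ≤ a.
  obtain ⟨n, hn⟩ : ∃ n : ℕ, a + 1 - t ≤ n := ⟨(a + 1 - t).toNat, Int.self_le_toNat _⟩
  induction n generalizing t M with
  | zero => exact .of_exactAt hd hM (fun q hq ↦ hMt q (by push_cast at hn; lia)) U
  | succ n ih =>
    have : M.IsGE t := (M.isGE_iff t).2 fun i hi ↦ hMt i hi
    have : QuasiIso (M.πTruncGE t) := (M.quasiIso_πTruncGE_iff t).2 inferInstance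
    -- K-injectivity of I lets it receive a morphism from the Gersten complex, and its injective
    -- terms are flasque. Passing through τ_{≥t} M gives access to the lowest cohomology sheaf as a
    -- subsheaf of the term in degree t.
    obtain ⟨I, j, _, _, hI⟩ := KInjectiveResolution.exists_kInjective_injective.{u} (M.truncGE t)
    have hI' : TermwiseFlasque I := fun n ↦ flasque_of_injective _
    have hj : QuasiIso (M.πTruncGE t ≫ j) := quasiIso_comp _ _ ‹_› ‹_›
    refine .of_quasiIso hd hM hI' (M.πTruncGE t ≫ j) ?_
    have hi (q : ℤ) := isIso_homologyMap _ hj q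
    have e (q : ℤ) : M.homology q ≅ I.homology q :=
      asIso (homologyMap (M.πTruncGE t ≫ j) q)
    obtain ⟨w, hw⟩ := exists_single_hom (M.truncGE t) t
    obtain ⟨A, ⟨R⟩⟩ := hG t le_rfl
    have := isIso_homologyMap (M.πTruncGE t) ‹_› t
    let R' := R.ofIso (asIso (homologyMap (M.πTruncGE t) t)).symm
    have := R'.quasiIso_augmentation t
    -- The morphism from the lowest cohomology sheaf to I extends, up to homotopy, over the
    -- resolution of this sheaf.
    obtain ⟨ψ, ⟨hψ⟩⟩ := exists_extension (R'.augmentation t) (w ≫ j)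
    -- The cone of ψ loses the cohomology sheaf in degree t and keeps those in higher degrees, so
    -- the induction hypothesis applies to it with t + 1.
    have hC (q : ℤ) (hq : q < t + 1) : (mappingCone ψ).ExactAt q :=
      mappingCone_exactAt_of_lt ψ (isIso_homologyMap_of_homotopy (R'.quasiIso_augmentation t) hψ
        (isIso_homologyMap_comp _ _ hw (isIso_homologyMap j ‹_› t))) (R'.exactAt t)
        (fun q hq ↦ (exactAt_iff_of_quasiIso _ hj q).1 (hMt q hq)) hq
    refine .of_mappingCone (φ := ψ) (R'.restrictionBijective t hU hat)
      (ih (termwiseFlasque_mappingCone (R'.termwiseFlasque t) hI') (t := t + 1) (by lia) hC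
        (fun q hq ↦ ?_) (by push_cast at hn; lia))
    obtain ⟨B, ⟨S⟩⟩ := hG q (by lia)
    have := CochainComplex.mappingCone.isIso_homologyMap_inr ψ q (R'.exactAt t q (by lia))
      (R'.exactAt t (q + 1) (by lia))
    exact ⟨B, ⟨S.ofIso ((asIso (homologyMap (CochainComplex.mappingCone.inr ψ) q)).symm ≪≫ (e q).symm)⟩⟩

end Devissage

end RefinedUnramified

namespace RefinedUnramified

open CategoryTheory Limits TopologicalSpace Opposite AlgebraicGeometry HomologicalComplex
open CochainComplex (mappingCone)

/-! ### Homotopy equivalences and the cone of a truncation map -/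

section Abelian

variable {A : Type u} [Category.{v} A] [Abelian A]

lemma isIso_homologyMap_homotopyEquiv_inv {K L : CochainComplex A ℤ} (e : HomotopyEquiv K L)
    (q : ℤ) : IsIso (homologyMap e.inv q) :=
  inferInstanceAs (IsIso (e.symm.toHomologyIso q).hom)

lemma quasiIso_homotopyEquiv_hom {K L : CochainComplex A ℤ} (e : HomotopyEquiv K L) :
    QuasiIso e.hom := inferInstance

lemma exactAt_of_lt_of_quasiIso_truncGE {L T : CochainComplex A ℤ} {s : ℤ} (j : L.truncGE s ⟶ T)
    (hj : QuasiIso j) {q : ℤ} (hq : q < s) : T.ExactAt q :=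
  (exactAt_iff_of_quasiIso j hj q).1 ((L.truncGE s).exactAt_of_isGE s q hq)

lemma isIso_homologyMap_πTruncGE_comp {L T : CochainComplex A ℤ} {s : ℤ} (j : L.truncGE s ⟶ T)
    (hj : QuasiIso j) {q : ℤ} (hq : s ≤ q) : IsIso (homologyMap (L.πTruncGE s ≫ j) q) := by
  have := L.quasiIsoAt_πTruncGE s q hq
  exact isIso_homologyMap_comp _ _ inferInstance inferInstance

/-- Only the cohomology of L in degrees < s contributes to the cone, shifted down by one degree;
hence the bound s - 1. -/
lemma mappingCone_exactAt_of_ge {L T : CochainComplex A ℤ} (φ : L ⟶ T) {s : ℤ}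
    (hφ : ∀ q, s ≤ q → IsIso (homologyMap φ q)) (hT : ∀ q < s, T.ExactAt q) {q : ℤ}
    (hq : s - 1 ≤ q) : (mappingCone φ).ExactAt q := by
  apply CochainComplex.mappingCone.exactAt_of_epi_of_mono
  · by_cases h : s ≤ q
    · have := hφ q h
      infer_instance
    · exact ⟨fun _ _ _ ↦ ((exactAt_iff_isZero_homology _ _).1 (hT q (by lia))).eq_of_src _ _⟩
  · have := hφ (q + 1) (by lia)
    infer_instance

/-- A K-injective complex is homotopy equivalent to a complex of injective objects. -/
lemma exists_homotopyEquiv_injective [IsGrothendieckAbelian.{w} A] (I : CochainComplex A ℤ)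
    [I.IsKInjective] : ∃ (I' : CochainComplex A ℤ) (_ : HomotopyEquiv I I'),
      ∀ n, Injective (I'.X n) := by
  obtain ⟨I', f, hf, _, h⟩ := KInjectiveResolution.exists_kInjective_injective.{w} I
  obtain ⟨e, -⟩ := (CochainComplex.IsKInjective.quasiIso_iff f).1 hf
  exact ⟨I', e, h⟩

end Abelian

section Homotopy

variable {X : Scheme.{u}} {M N : CochainComplex (AbSheaf (zar X)) ℤ}

lemma IsCocycle.isCoboundary_sub_of_homotopy {f g : M ⟶ N} (h : Homotopy f g) {n : ℤ} {U : Opens X}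
    {a : sec (M.X n) U} (ha : IsCocycle M a) :
    IsCoboundary N (onSec (f.f n) U a - onSec (g.f n) U a) := by
  have hn := h.comm n
  rw [dNext_eq h.hom (show (ComplexShape.up ℤ).Rel n (n + 1) from rfl),
    prevD_eq h.hom (show (ComplexShape.up ℤ).Rel (n - 1) n by simp)] at hn
  refine ⟨onSec (h.hom n (n - 1)) U a, ?_⟩
  rw [hn, onSec_add, onSec_add, onSec_comp, onSec_comp, ha, map_zero]
  abel

lemma IsCocycle.isCoboundary_sub_of_homotopyEquiv (e : HomotopyEquiv M N) {n : ℤ} {U : Opens X}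
    {a : sec (M.X n) U} (ha : IsCocycle M a) :
    IsCoboundary M (onSec (e.inv.f n) U (onSec (e.hom.f n) U a) - a) :=
  ha.isCoboundary_sub_of_homotopy e.homotopyHomInvId

lemma IsCocycle.isCoboundary_of_homotopyEquiv (e : HomotopyEquiv M N) {n : ℤ} {U : Opens X}
    {a : sec (M.X n) U} (ha : IsCocycle M a) (h : IsCoboundary N (onSec (e.hom.f n) U a)) :
    IsCoboundary M a := by
  have := (h.map e.inv).sub (ha.isCoboundary_sub_of_homotopyEquiv e)
  rwa [sub_sub_cancel] at this

lemma RestrictionBijective.of_homotopyEquiv (e : HomotopyEquiv M N) {U : Opens X} {a : ℤ}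
    (h : RestrictionBijective N U a) : RestrictionBijective M U a := by
  constructor
  · intro n hn m hm hm'
    refine hm.isCoboundary_of_homotopyEquiv e (h.1 n hn _ (hm.map e.hom) ?_)
    rw [← onSec_res]
    exact hm'.map e.hom
  · intro n hn m hm
    obtain ⟨m', hm', hb⟩ := h.2 n hn _ (hm.map e.hom)
    refine ⟨onSec (e.inv.f n) ⊤ m', hm'.map e.inv, ?_⟩
    have := (hb.map e.inv).sub (hm.isCoboundary_sub_of_homotopyEquiv e)
    convert this using 1
    rw [map_sub, onSec_res]
    abel

end Homotopy

/-! ### Comparison of a complex with its truncation near points of small codimension -/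

section Truncation

variable {X : Scheme.{u}}

/-- Cohomology classes in degree `i` of the sections of `T` over neighbourhoods of `F_j X` lift
along `φ`, on smaller neighbourhoods. -/
def LiftsOn {L T : CochainComplex (AbSheaf (zar X)) ℤ} (φ : L ⟶ T) (i j : ℤ) : Prop :=
  ∀ (U : Opens X) (t : sec (T.X i) U), F X j ⊆ U → IsCocycle T t →
    ∃ (V : Opens X) (hV : V ≤ U) (l : sec (L.X i) V), F X j ⊆ V ∧ IsCocycle L l ∧
      IsCoboundary T (res _ hV t - onSec (φ.f i) V l)

/-- Cohomology classes in degree `i` of the sections of `L` over neighbourhoods of `F_j X` that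
vanish in `T`, vanish on smaller neighbourhoods. -/
def ReflectsZeroOn {L T : CochainComplex (AbSheaf (zar X)) ℤ} (φ : L ⟶ T) (i j : ℤ) : Prop :=
  ∀ (U : Opens X) (l : sec (L.X i) U), F X j ⊆ U → IsCocycle L l →
    IsCoboundary T (onSec (φ.f i) U l) →
    ∃ (V : Opens X) (hV : V ≤ U), F X j ⊆ V ∧ IsCoboundary L (res _ hV l)

variable {L T L' T' : CochainComplex (AbSheaf (zar X)) ℤ}

/-- A lift in L' is pushed to L by β, so β can be any morphism; only the target has to be changed by
a homotopy equivalence. -/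
lemma LiftsOn.of_homotopyEquiv {φ : L ⟶ T} {β : L' ⟶ L} (e : HomotopyEquiv T T') {i j : ℤ}
    (h : LiftsOn (β ≫ φ ≫ e.hom) i j) : LiftsOn φ i j := by
  intro U t hU ht
  obtain ⟨V, hV, l, hFV, hl, hb⟩ := h U _ hU (ht.map e.hom)
  refine ⟨V, hV, onSec (β.f i) V l, hFV, hl.map β,
    ((ht.restrict hV).sub ((hl.map β).map φ)).isCoboundary_of_homotopyEquiv e ?_⟩
  rw [map_sub, onSec_res]
  exact hb

/-- A class that vanishes in T also vanishes in T', so γ can be any morphism; only the source has to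
be changed by a homotopy equivalence. -/
lemma ReflectsZeroOn.of_homotopyEquiv {φ : L ⟶ T} {γ : T ⟶ T'} (e : HomotopyEquiv L L') {i j : ℤ}
    (h : ReflectsZeroOn (e.inv ≫ φ ≫ γ) i j) : ReflectsZeroOn φ i j := by
  intro U l hU hl hb
  obtain ⟨V, hV, hFV, hb'⟩ := h U _ hU (hl.map e.hom) (by
    have h := ((hb.add ((hl.isCoboundary_sub_of_homotopyEquiv e).map φ))).map γ
    rw [← map_add, add_sub_cancel] at h
    exact h)
  refine ⟨V, hV, hFV, (hl.restrict hV).isCoboundary_of_homotopyEquiv e ?_⟩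
  rwa [onSec_res]

variable [NoetherianSpace X]

lemma LiftsOn.of_exactAt (hd : topologicalKrullDim X ≠ ⊤) {φ : L ⟶ T} (hL : TermwiseFlasque L)
    (hT : TermwiseFlasque T) {i j s : ℤ} (hj : j = i - s + 1)
    (h : ∀ q, s - 1 ≤ q → (mappingCone φ).ExactAt q) : LiftsOn φ i j := by
  intro U t hU ht
  -- The j + 1 degrees s - 1, …, i of the cone are exact, which yields a neighbourhood of F_j X; for
  -- negative j the set F_j X is empty. A primitive (l, t') of (0, t) satisfies dl = 0 and t = φ(l)
  -- + dt', so l is the lift.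
  obtain ⟨V, hV, hFV, hb⟩ := exists_isCoboundary_restrict hd
    (termwiseFlasque_mappingCone (φ := φ) hL hT) (j + 1).toNat i (fun q hq hq' ↦ h q (by lia)) U
    (coneMk φ rfl 0 t) ((isCocycle_coneMk φ rfl rfl).2
      ⟨map_zero _, by rw [map_zero, zero_add]; exact ht⟩)
  rw [res_coneMk, isCoboundary_coneMk φ (k := i - 1) rfl (by lia)] at hb
  obtain ⟨l, t', h1, h2⟩ := hb
  refine ⟨V, hV, l, fun x hx ↦ hFV x (hU hx) (F_mono X (by lia) hx),
    by simpa [IsCocycle] using h1.symm, t', ?_⟩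
  rw [h2, add_sub_cancel_left]

lemma ReflectsZeroOn.of_exactAt (hd : topologicalKrullDim X ≠ ⊤) {φ : L ⟶ T}
    (hL : TermwiseFlasque L) (hT : TermwiseFlasque T) {i j s : ℤ} (hj : j = i - s)
    (h : ∀ q, s - 1 ≤ q → (mappingCone φ).ExactAt q) : ReflectsZeroOn φ i j := by
  rintro U l hU hl ⟨t, ht⟩
  have hi : i - 1 + 1 = i := by lia
  -- A primitive t of φ(l) gives the cocycle (l, -t) of degree i - 1 in the cone, where the exact
  -- degrees are s - 1, …, i - 1, again j + 1 many. The first component of its primitive is one of l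
  -- up to sign.
  obtain ⟨V, hV, hFV, hb⟩ := exists_isCoboundary_restrict hd
    (termwiseFlasque_mappingCone (φ := φ) hL hT) (j + 1).toNat (i - 1)
    (fun q hq hq' ↦ h q (by lia)) U
    (coneMk φ hi l (-t)) ((isCocycle_coneMk φ hi rfl).2
      ⟨hl, by rw [map_neg, ht, add_neg_cancel]⟩)
  rw [res_coneMk, isCoboundary_coneMk φ (k := i - 1 - 1) hi (by lia)] at hb
  obtain ⟨l', t', h1, -⟩ := hb
  exact ⟨V, hV, fun x hx ↦ hFV x (hU hx) (F_mono X (by lia) hx), -l', by rw [h1, map_neg]⟩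

end Truncation

/-! ### The truncated total direct image -/

section DirectImage

variable {X : Scheme.{u}} {C : Type u} [SmallCategory C] {J : GrothendieckTopology C}
  (v : Opens X ⥤ C)

/-- The direct image of a complex of injective sheaves is termwise flasque. -/
lemma termwiseFlasque_directImage [RepresentablyFlat v] [v.IsContinuous (zar X) J]
    (I : CochainComplex (AbSheaf J) ℤ) (hI : ∀ n, Injective (I.X n)) :
    TermwiseFlasque (((v.sheafPushforwardContinuous AddCommGrpCat.{u} (zar X) J).mapHomologicalComplex
      (.up ℤ)).obj I) := by
  intro n U V h
  -- As v preserves finite limits, it sends open inclusions to monomorphisms, along which sections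
  -- of injective sheaves extend.
  have := preservesFiniteLimits_of_flat v
  exact surjective_map_of_injective (I.X n) (v.map (homOfLE h))

variable [NoetherianSpace X] [RepresentablyFlat v] [v.IsContinuous (zar X) J]

/-- The comparison of the cohomology of a complex with that of the truncation of its direct
image. -/
theorem truncation_properties (hd : topologicalKrullDim X ≠ ⊤)
    (K : CochainComplex (AbSheaf J) ℤ)
    (hK : ∀ i : ℤ, ∃ A : ℕ → X → AddCommGrpCat.{u},
      Nonempty (GerstenResolution ((totalDirectImage v K).homology i) A))
    (i s : ℤ) :
    LiftsOn ((totalDirectImage v K).πTruncGE s ≫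
        toInjRepl ((totalDirectImage v K).truncGE s)) i (i - s + 1) ∧
      ReflectsZeroOn ((totalDirectImage v K).πTruncGE s ≫
        toInjRepl ((totalDirectImage v K).truncGE s)) i (i - s) ∧
      ∀ (m : ℤ) (U : Opens X), F X m ⊆ U →
        RestrictionBijective (injRepl ((totalDirectImage v K).truncGE s)) U (m + s) := by
  -- The vanishing arguments need flasque terms, which K-injectivity alone does not supply; both
  -- replacements are exchanged for homotopy equivalent complexes with injective terms.
  obtain ⟨I, e, hI⟩ := exists_homotopyEquiv_injective.{u} (injRepl K)
  obtain ⟨T, g, hT⟩ :=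
    exists_homotopyEquiv_injective.{u} (injRepl ((totalDirectImage v K).truncGE s))
  have hL' := termwiseFlasque_directImage v I hI
  have hT' : TermwiseFlasque T := fun n ↦ flasque_of_injective _
  let e' : HomotopyEquiv (totalDirectImage v K) _ :=
    (v.sheafPushforwardContinuous AddCommGrpCat.{u} (zar X) J).mapHomotopyEquiv e
  have hj := quasiIso_comp _ _ (toInjRepl_quasiIso ((totalDirectImage v K).truncGE s))
    (quasiIso_homotopyEquiv_hom g)
  have hTs (q : ℤ) (hq : q < s) := exactAt_of_lt_of_quasiIso_truncGE _ hj hq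
  have hiso (q : ℤ) (hq : s ≤ q) := isIso_homologyMap_πTruncGE_comp _ hj hq
  have hC (q : ℤ) (hq : s - 1 ≤ q) := mappingCone_exactAt_of_ge
    (e'.inv ≫ (totalDirectImage v K).πTruncGE s ≫
        toInjRepl ((totalDirectImage v K).truncGE s) ≫ g.hom) (fun q hq ↦
    isIso_homologyMap_comp _ _ (isIso_homologyMap_homotopyEquiv_inv e' q) (hiso q hq)) hTs hq
  refine ⟨.of_homotopyEquiv g (β := e'.inv) ?_, .of_homotopyEquiv e' (γ := g.hom) ?_, ?_⟩
  · rw [Category.assoc]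
    exact .of_exactAt hd hL' hT' rfl hC
  · rw [Category.assoc]
    exact .of_exactAt hd hL' hT' rfl hC
  · intro m U hU
    -- In degrees ≥ s the cohomology sheaves of T are those of the total direct image, so they
    -- inherit the given Gersten resolutions.
    refine .of_homotopyEquiv g (restrictionBijective_of_gersten hd hU hT' le_rfl hTs fun q hq ↦ ?_)
    obtain ⟨A, ⟨R⟩⟩ := hK q
    exact ⟨A, ⟨R.ofIso (@asIso _ _ _ _ _ (hiso q hq)).symm⟩⟩

end DirectImage

end RefinedUnramified

namespace RefinedUnramified

open CategoryTheory Limits TopologicalSpace Opposite AlgebraicGeometry HomologicalComplex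

/-! ### Cohomology classes and their representing sections -/

section Classes

/-- The homology class `c` is represented by the cocycle `a`. -/
def IsClassOf {K : CochainComplex AddCommGrpCat.{u} ℤ} {i : ℤ} (a : K.X i) (c : K.homology i) :
    Prop :=
  ∃ z : K.cycles i, K.iCycles i z = a ∧ K.homologyπ i z = c

variable {K L : CochainComplex AddCommGrpCat.{u} ℤ} {i : ℤ}

lemma exists_isClassOf_of_cocycle {a : K.X i} (ha : K.d i (i + 1) a = 0) :
    ∃ c : K.homology i, IsClassOf a c := by
  have hS := (ShortComplex.mk (K.iCycles i) (K.d i (i + 1)) (by simp)).exact_of_f_is_kernel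
    (K.cyclesIsKernel i (i + 1) (by simp))
  obtain ⟨z, hz⟩ := (ShortComplex.ab_exact_iff _).1 hS a ha
  exact ⟨_, z, hz, rfl⟩

lemma exists_isClassOf (c : K.homology i) : ∃ a : K.X i, IsClassOf a c := by
  obtain ⟨z, rfl⟩ := (AddCommGrpCat.epi_iff_surjective (K.homologyπ i)).1 inferInstance c
  exact ⟨_, z, rfl, rfl⟩

lemma IsClassOf.d_eq_zero {a : K.X i} {c : K.homology i} (h : IsClassOf a c) :
    K.d i (i + 1) a = 0 := by
  obtain ⟨z, rfl, -⟩ := h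
  exact ConcreteCategory.congr_hom (K.iCycles_d i (i + 1)) z

lemma IsClassOf.sub {a b : K.X i} {c d : K.homology i} (h : IsClassOf a c) (h' : IsClassOf b d) :
    IsClassOf (a - b) (c - d) := by
  obtain ⟨z, rfl, rfl⟩ := h
  obtain ⟨w, rfl, rfl⟩ := h'
  exact ⟨z - w, map_sub _ _ _, map_sub _ _ _⟩

lemma IsClassOf.map {a : K.X i} {c : K.homology i} (h : IsClassOf a c) (f : K ⟶ L) :
    IsClassOf (f.f i a) (homologyMap f i c) := by
  obtain ⟨z, rfl, rfl⟩ := h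
  exact ⟨cyclesMap f i z, ConcreteCategory.congr_hom (cyclesMap_i f i) z,
    (ConcreteCategory.congr_hom (homologyπ_naturality f i) z).symm⟩

lemma IsClassOf.eq_zero_iff {a : K.X i} {c : K.homology i} (h : IsClassOf a c) :
    c = 0 ↔ ∃ b : K.X (i - 1), K.d (i - 1) i b = a := by
  obtain ⟨z, rfl, rfl⟩ := h
  have hS := (ShortComplex.mk (K.toCycles (i - 1) i) (K.homologyπ i) (by simp)).exact_of_g_is_cokernel
    (K.homologyIsCokernel (i - 1) i (by simp))
  rw [ShortComplex.ab_exact_iff] at hS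
  constructor
  · intro hz
    obtain ⟨b, hb⟩ := hS z hz
    exact ⟨b, by rw [← hb]; exact (ConcreteCategory.congr_hom (K.toCycles_i (i - 1) i) b).symm⟩
  · rintro ⟨b, hb⟩
    have : K.toCycles (i - 1) i b = z := (AddCommGrpCat.mono_iff_injective (K.iCycles i)).1
      inferInstance ((ConcreteCategory.congr_hom (K.toCycles_i (i - 1) i) b).trans hb)
    rw [← this]
    exact ConcreteCategory.congr_hom (K.toCycles_comp_homologyπ (i - 1) i) b

end Classes

section Sections

variable {X : Scheme.{u}} {M N : CochainComplex (AbSheaf (zar X)) ℤ} {i : ℤ} {U V : Opens X}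

/-- The cohomology class `c` is represented by the section `a`. -/
def Represents (a : sec (M.X i) U) (c : (sectionsCohomology M i).obj (op U)) : Prop :=
  IsClassOf (K := ((sectionsComplex (zar X)).obj M).obj (op U)) a c

lemma IsCocycle.exists_represents {a : sec (M.X i) U} (ha : IsCocycle M a) :
    ∃ c : (sectionsCohomology M i).obj (op U), Represents a c :=
  exists_isClassOf_of_cocycle (K := ((sectionsComplex (zar X)).obj M).obj (op U)) ha

lemma exists_represents (c : (sectionsCohomology M i).obj (op U)) :
    ∃ a : sec (M.X i) U, IsCocycle M a ∧ Represents a c := by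
  obtain ⟨a, ha⟩ := exists_isClassOf (K := ((sectionsComplex (zar X)).obj M).obj (op U)) c
  exact ⟨a, ha.d_eq_zero, ha⟩

lemma Represents.sub {a b : sec (M.X i) U} {c d : (sectionsCohomology M i).obj (op U)}
    (h : Represents a c) (h' : Represents b d) : Represents (a - b) (c - d) :=
  IsClassOf.sub h h'

lemma Represents.eq_zero_iff {a : sec (M.X i) U} {c : (sectionsCohomology M i).obj (op U)}
    (h : Represents a c) : c = 0 ↔ IsCoboundary M a :=
  IsClassOf.eq_zero_iff h

lemma Represents.res {a : sec (M.X i) U} {c : (sectionsCohomology M i).obj (op U)}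
    (h : Represents a c) (hV : V ≤ U) :
    Represents (RefinedUnramified.res _ hV a) ((sectionsCohomology M i).map (homOfLE hV).op c) :=
  IsClassOf.map h (((sectionsComplex (zar X)).obj M).map (homOfLE hV).op)

lemma Represents.map {a : sec (M.X i) U} {c : (sectionsCohomology M i).obj (op U)}
    (h : Represents a c) (φ : M ⟶ N) :
    Represents (onSec (φ.f i) U a) ((sectionsCohomologyMap φ i).app (op U) c) :=
  IsClassOf.map h (((sectionsComplex (zar X)).map φ).app (op U))

end Sections

end RefinedUnramified

namespace RefinedUnramified

open CategoryTheory Limits TopologicalSpace Opposite AlgebraicGeometry HomologicalComplex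

/-! ### Values on F_j X and the algebraic criterion -/

section Colimit

variable {X : Scheme.{u}}

instance (j : ℤ) : IsFiltered (OpensContaining X j)ᵒᵖ :=
  have : IsCofiltered (OpensContaining X j) :=
    { nonempty := ⟨⟨⊤, fun _ _ ↦ trivial⟩⟩
      cone_objs U V := ⟨⟨U.1 ⊓ V.1, fun _ hx ↦ ⟨U.2 hx, V.2 hx⟩⟩,
        homOfLE (show U.1 ⊓ V.1 ≤ U.1 from inf_le_left),
        homOfLE (show U.1 ⊓ V.1 ≤ V.1 from inf_le_right), trivial⟩
      cone_maps U _ _ _ := ⟨U, 𝟙 U, Subsingleton.elim _ _⟩ }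
  inferInstance

variable (P Q : (Opens X)ᵒᵖ ⥤ AddCommGrpCat.{u})

/-- The class on `F_j X` of an element over a neighbourhood of `F_j X`. -/
noncomputable def onF.mk {j : ℤ} {U : Opens X} (hU : F X j ⊆ U) : P.obj (op U) →+ onF P j :=
  (colimit.ι ((OpensContaining.incl X j).op ⋙ P) (op ⟨U, hU⟩)).hom

variable {P Q} {j : ℤ}

lemma onF.exists_mk (z : onF P j) :
    ∃ (U : Opens X) (hU : F X j ⊆ U) (a : P.obj (op U)), onF.mk P hU a = z := by
  obtain ⟨⟨U⟩, a, h⟩ := Concrete.colimit_exists_rep ((OpensContaining.incl X j).op ⋙ P) z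
  exact ⟨U.1, U.2, a, h⟩

lemma onF.mk_res {U V : Opens X} (hV : F X j ⊆ V) (h : V ≤ U) (a : P.obj (op U)) :
    onF.mk P hV (P.map (homOfLE h).op a) = onF.mk P (hV.trans h) a :=
  ConcreteCategory.congr_hom (colimit.w ((OpensContaining.incl X j).op ⋙ P)
    (homOfLE (show (⟨V, hV⟩ : OpensContaining X j) ≤ ⟨U, hV.trans h⟩ from h)).op) a

lemma onF.mk_eq_zero_iff {U : Opens X} (hU : F X j ⊆ U) (a : P.obj (op U)) :
    onF.mk P hU a = 0 ↔ ∃ (V : Opens X) (h : V ≤ U), F X j ⊆ V ∧ P.map (homOfLE h).op a = 0 := by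
  constructor
  · intro h
    obtain ⟨⟨V⟩, f, g, hfg⟩ := Concrete.colimit_exists_of_rep_eq.{u}
      ((OpensContaining.incl X j).op ⋙ P) (i := op ⟨U, hU⟩) (j := op ⟨U, hU⟩) a 0
      (h.trans (map_zero (onF.mk P hU)).symm)
    refine ⟨V.1, leOfHom f.unop, V.2, ?_⟩
    exact hfg.trans (map_zero (P.map ((OpensContaining.incl X j).op.map g)).hom)
  · rintro ⟨V, h, hV, h0⟩
    rw [← onF.mk_res hV h, h0, map_zero]

lemma onF.map_mk (τ : P ⟶ Q) {U : Opens X} (hU : F X j ⊆ U) (a : P.obj (op U)) :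
    onF.map τ j (onF.mk P hU a) = onF.mk Q hU (τ.app (op U) a) :=
  ConcreteCategory.congr_hom (ι_colimMap (Functor.whiskerLeft (OpensContaining.incl X j).op τ)
    (op ⟨U, hU⟩)) a

lemma onF.restrict_mk {j' : ℤ} (h : j ≤ j') {U : Opens X} (hU : F X j' ⊆ U) (a : P.obj (op U)) :
    onF.restrict P h (onF.mk P hU a) = onF.mk P ((F_mono X h).trans hU) a :=
  ConcreteCategory.congr_hom (colimit.ι_pre ((OpensContaining.incl X j).op ⋙ P)
    (OpensContaining.ofLE X h).op (op ⟨U, hU⟩)) a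

lemma onF.ofTop_eq (a : P.obj (op ⊤)) :
    onF.ofTop P j a = onF.mk P (U := ⊤) (fun _ _ ↦ trivial) a := rfl

/-- Two injective homomorphisms with the same image differ by a unique isomorphism. -/
lemma existsUnique_addEquiv {G R B : Type*} [AddCommGroup G] [AddCommGroup R] [AddCommGroup B]
    (f : R →+ B) (g : G →+ B) (hf : Function.Injective f) (hg : Function.Injective g)
    (h : f.range = g.range) : ∃! φ : G ≃+ R, ∀ z, f (φ z) = g z := by
  have key (z : G) : f ((AddMonoidHom.ofInjective hf).symm
      (AddEquiv.addSubgroupCongr h.symm (AddMonoidHom.ofInjective hg z))) = g z := by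
    rw [AddMonoidHom.apply_ofInjective_symm]
    rfl
  refine ⟨(AddMonoidHom.ofInjective hg).trans ((AddEquiv.addSubgroupCongr h.symm).trans
    (AddMonoidHom.ofInjective hf).symm), key, fun ψ hψ ↦ ?_⟩
  ext z
  exact hf ((hψ z).trans (key z).symm)

/-- The algebraic criterion for the comparison of `Q(X)` with the refined unramified part
of `P`. -/
theorem existsUnique_equiv_range_restrict (τ : P ⟶ Q) (j : ℤ)
    (h1 : ∀ (U : Opens X) (t : Q.obj (op U)), F X (j + 1) ⊆ U → ∃ (V : Opens X) (hV : V ≤ U)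
      (l : P.obj (op V)), F X (j + 1) ⊆ V ∧ τ.app (op V) l = Q.map (homOfLE hV).op t)
    (h2 : ∀ (U : Opens X) (l : P.obj (op U)), F X j ⊆ U → τ.app (op U) l = 0 →
      ∃ (V : Opens X) (hV : V ≤ U), F X j ⊆ V ∧ P.map (homOfLE hV).op l = 0)
    (h3 : ∀ (U : Opens X), F X (j + 1) ⊆ U →
      Function.Surjective (Q.map (homOfLE (le_top : U ≤ ⊤)).op))
    (h4 : ∀ (U : Opens X), F X j ⊆ U → ∀ t : Q.obj (op ⊤),
      Q.map (homOfLE (le_top : U ≤ ⊤)).op t = 0 → t = 0) :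
    ∃! φ : Q.obj (op ⊤) ≃+ (onF.restrict P (j := j) (j' := j + 1) (by lia)).hom.range,
      ∀ z, onF.map τ j (φ z : onF P j) = onF.ofTop Q j z := by
  -- Both groups are compared inside Q(F_j X). Injectivity follows from `h2` for the part of P, and
  -- from `h4` for Q(X).
  refine existsUnique_addEquiv ((onF.map τ j).hom.comp (AddSubgroup.subtype _)) (onF.ofTop Q j).hom
    ?_ ?_ ?_
  · refine Function.Injective.comp (g := (onF.map τ j).hom) (f := Subtype.val) ?_
      Subtype.val_injective
    rw [injective_iff_map_eq_zero]
    intro z hz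
    obtain ⟨U, hU, a, rfl⟩ := onF.exists_mk z
    obtain ⟨V, h, hV, h0⟩ := (onF.mk_eq_zero_iff hU _).1 ((onF.map_mk τ hU a).symm.trans hz)
    rw [← onF.mk_res hV h, onF.mk_eq_zero_iff]
    exact h2 V _ hV ((ConcreteCategory.congr_hom (τ.naturality (homOfLE h).op) a).trans h0)
  · rw [injective_iff_map_eq_zero]
    intro t ht
    obtain ⟨V, h, hV, h0⟩ := (onF.mk_eq_zero_iff _ _).1 ht
    exact h4 V hV t h0
  -- Equality of images: by `h3`, the image in Q of a class on F_{j+1} X extends to X; by `h1`, the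
  -- restriction of a class on X to F_{j+1} X lifts to P.
  · ext b
    constructor
    · rintro ⟨⟨_, x, rfl⟩, rfl⟩
      obtain ⟨U, hU, a, rfl⟩ := onF.exists_mk x
      obtain ⟨t, ht⟩ := h3 U hU (τ.app _ a)
      refine ⟨t, ?_⟩
      change onF.ofTop Q j t = onF.map τ j (onF.restrict P _ (onF.mk P hU a))
      rw [onF.restrict_mk, onF.map_mk, ← ht, onF.mk_res, onF.ofTop_eq]
    · rintro ⟨t, rfl⟩
      obtain ⟨V, hV, l, hFV, hl⟩ := h1 ⊤ t (fun _ _ ↦ trivial)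
      refine ⟨⟨_, onF.mk P hFV l, rfl⟩, ?_⟩
      change onF.map τ j (onF.restrict P _ (onF.mk P hFV l)) = onF.ofTop Q j t
      rw [onF.restrict_mk, onF.map_mk, hl, onF.mk_res, onF.ofTop_eq]

end Colimit

end RefinedUnramified

namespace RefinedUnramified

open CategoryTheory Limits TopologicalSpace Opposite AlgebraicGeometry

/-! ### Schemes of finite type over a field are Noetherian of finite dimension -/

section Dimension

/-- The dimension of a space is bounded by the dimensions of the members of an open cover. -/
lemma topologicalKrullDim_le_of_cover {X : Type*} [TopologicalSpace X] {ι : Type*} {Y : ι → Type*}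
    [∀ i, TopologicalSpace (Y i)] (f : ∀ i, Y i → X) (hf : ∀ i, Topology.IsOpenEmbedding (f i))
    (hc : ∀ x, ∃ i, x ∈ Set.range (f i)) {n : ℕ} (hn : ∀ i, topologicalKrullDim (Y i) ≤ n) :
    topologicalKrullDim X ≤ n := by
  refine iSup_le fun p ↦ ?_
  -- A member of the cover that meets the smallest term of the chain meets all of them, and so its
  -- irreducible closed subsets contain a chain of the same length.
  obtain ⟨x, hx⟩ := p.head.isIrreducible.nonempty
  obtain ⟨i, y, rfl⟩ := hc x
  have hp (k : Fin (p.length + 1)) : (f i ⁻¹' (p k)).Nonempty :=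
    ⟨y, (p.strictMono.monotone (Fin.zero_le k) : p.head ≤ p k) hx⟩
  let q : LTSeries {V : IrreducibleCloseds X | (f i ⁻¹' V).Nonempty} :=
    LTSeries.mk p.length (fun k ↦ ⟨p k, hp k⟩) p.strictMono
  exact (Order.LTSeries.length_le_krullDim (q.map _ (IrreducibleCloseds.orderIsoOfIsOpenEmbedding
    (f i) (hf i)).symm.strictMono)).trans (hn i)

/-- R is a quotient of a polynomial ring in n variables over k, which has dimension n. -/
lemma exists_ringKrullDim_le {k R : Type*} [Field k] [CommRing R] [Algebra k R]
    [Algebra.FiniteType k R] : ∃ n : ℕ, ringKrullDim R ≤ n := by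
  obtain ⟨n, f, hf⟩ := Algebra.FiniteType.iff_quotient_mvPolynomial''.1 ‹Algebra.FiniteType k R›
  refine ⟨n, (ringKrullDim_le_of_surjective f.toRingHom hf).trans ?_⟩
  simp

variable {k : Type u} [Field k] {X : Scheme.{u}}

lemma exists_topologicalKrullDim_Spec_le {R : CommRingCat.{u}} (g : Spec R ⟶ Spec (.of k))
    [hg : LocallyOfFiniteType g] : ∃ n : ℕ, topologicalKrullDim (Spec R) ≤ n := by
  obtain ⟨φ, rfl⟩ := Spec.map_surjective g
  algebraize [φ.hom]
  have : Algebra.FiniteType k R :=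
    (HasRingHomProperty.Spec_iff (P := @LocallyOfFiniteType)).1 hg
  obtain ⟨n, hn⟩ := exists_ringKrullDim_le (k := k) (R := R)
  exact ⟨n, (PrimeSpectrum.topologicalKrullDim_eq_ringKrullDim R).trans_le hn⟩

lemma noetherianSpace_of_finiteType (f : X ⟶ Spec (.of k)) [LocallyOfFiniteType f]
    [QuasiCompact f] : NoetherianSpace X := by
  have := LocallyOfFiniteType.isLocallyNoetherian f
  have : CompactSpace X := QuasiCompact.compactSpace_of_compactSpace f
  have : IsNoetherian X := {}
  infer_instance

lemma topologicalKrullDim_ne_top_of_finiteType (f : X ⟶ Spec (.of k)) [LocallyOfFiniteType f]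
    [QuasiCompact f] : topologicalKrullDim X ≠ ⊤ := by
  have : CompactSpace X := QuasiCompact.compactSpace_of_compactSpace f
  let 𝒰 := X.affineOpenCover.openCover.finiteSubcover
  have h (i : 𝒰.I₀) : ∃ n : ℕ, topologicalKrullDim (𝒰.X i) ≤ n :=
    have : LocallyOfFiniteType (𝒰.f i ≫ f) := inferInstance
    exists_topologicalKrullDim_Spec_le (hg := this)
  choose n hn using h
  have hle : topologicalKrullDim X ≤ (Finset.univ.sup n : ℕ) :=
    topologicalKrullDim_le_of_cover (fun i ↦ 𝒰.f i) (fun i ↦ (𝒰.f i).isOpenEmbedding)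
      (fun x ↦ ⟨𝒰.idx x, 𝒰.covers x⟩)
      (fun i ↦ (hn i).trans (by exact_mod_cast Finset.le_sup (Finset.mem_univ i)))
  exact (hle.trans_lt (WithBot.coe_lt_coe.2 (ENat.natCast_lt_top _))).ne

end Dimension

end RefinedUnramified

/-! ### The main theorem -/

open CategoryTheory TopologicalSpace Opposite AlgebraicGeometry RefinedUnramified in
theorem theorem1p8 (k : Type u) [Field k] (X : Scheme.{u}) (f : X ⟶ Spec (.of k))
    [IsSeparated f] [LocallyOfFiniteType f] [QuasiCompact f] (hX : IsEquidimensional X)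
    {C : Type u} [SmallCategory C] (J : GrothendieckTopology C)
    (v : Opens X ⥤ C) [RepresentablyFlat v] [v.IsContinuous (zar X) J]
    (K : CochainComplex (AbSheaf J) ℤ) (A : ℤ → X → AddCommGrpCat.{u})
    (hK : ∀ i : ℤ, Nonempty (GerstenResolution ((totalDirectImage v K).homology i)
      fun p x ↦ A (i + p) x))
    (i s : ℤ) :
    ∃! φ : (hypercohomology ((totalDirectImage v K).truncGE s) i).obj (op ⊤) ≃+
        refinedUnramified v K i (i - s),
      ∀ z, onF.map (toTruncation v K i s) (i - s) (φ z : onF (hypercohomologyOnOpens v K i) (i - s)) =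
        onF.ofTop (hypercohomology ((totalDirectImage v K).truncGE s) i) (i - s) z := by
  have := noetherianSpace_of_finiteType f
  obtain ⟨h1, h2, h3⟩ := truncation_properties v (topologicalKrullDim_ne_top_of_finiteType f) K
    (fun q ↦ ⟨_, hK q⟩) i s
  refine existsUnique_equiv_range_restrict (toTruncation v K i s) (i - s) ?_ ?_ ?_ ?_
  · intro U t hU
    obtain ⟨a, ha, hat⟩ := exists_represents t
    obtain ⟨V, hV, l, hFV, hl, hb⟩ := h1 U a hU ha
    obtain ⟨c, hc⟩ := hl.exists_represents
    exact ⟨V, hV, c, hFV, (sub_eq_zero.1 (((hat.res hV).sub (hc.map _)).eq_zero_iff.2 hb)).symm⟩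
  · intro U c hU hc
    obtain ⟨a, ha, hac⟩ := exists_represents (M := totalDirectImage v K) (i := i) (U := U) c
    obtain ⟨V, hV, hFV, hb⟩ := h2 U a hU ha ((hac.map _).eq_zero_iff.1 hc)
    exact ⟨V, hV, hFV, (hac.res hV).eq_zero_iff.2 hb⟩
  · intro U hU c
    obtain ⟨a, ha, hac⟩ := exists_represents c
    -- Here U contains F_m X with m = i - s + 1, so the bound m + s is i + 1 and degree i is in the
    -- range of surjectivity.
    obtain ⟨b, hb, hb'⟩ := (h3 _ U hU).2 i (by lia) a ha
    obtain ⟨c', hc'⟩ := hb.exists_represents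
    exact ⟨c', (sub_eq_zero.1 ((hac.sub (hc'.res le_top)).eq_zero_iff.2 hb')).symm⟩
  · intro U hU c hc
    obtain ⟨a, ha, hac⟩ := exists_represents c
    -- Here m = i - s, so the bound is i, the last degree in which injectivity is available.
    exact hac.eq_zero_iff.2 ((h3 _ U hU).1 i (by lia) a ha ((hac.res le_top).eq_zero_iff.1 hc))
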